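/- Let $p$ be a prime, let $(R,\mathfrak m)$ be a Noetherian local ring of characteristic $p$, let $I$ be a proper ideal of $R$ with $\dim(R/I)<\dim R$, and let $s>0$ be a real number. Let $R\bowtie I=\{(r,r')\in R\times R : r'-r\in I\}$ be the amalgamated duplication of $R$ along $I$, a subring of $R\times R$; it is again a local ring. For a local ring $(A,\mathfrak n)$ of characteristic $p$ and dimension $d$ put $$h_s(A)=\lim_{e\to\infty}\frac{\ell_A\bigl(A/(\mathfrak n^{\lceil sp^e\rceil}+\mathfrak n^{[p^e]})\bigr)}{p^{ed}},\qquad e_s(A)=\frac{h_s(A)}{\mathcal H_s(d)},\qquad \mathcal H_s(d)=\sum_{i=0}^{\lfloor s\rfloor}\frac{(-1)^i}{d!}\binom di(s-i)^d,$$ where $\ell_A$ denotes length and $\mathfrak n^{[p^e]}$ is the ideal generated by the $p^e$-th powers of the elements of $\mathfrak n$. Then the limits defining $h_s(R)$ and $h_s(R\bowtie I)$ exist, and $$h_s(R\bowtie I)=2\,h_s(R),\qquad e_s(R\bowtie I)=2\,e_s(R).$$ -/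

import Mathlib

open Filter Topology

/-- The dimension `dim R` as a natural number. For a nontrivial Noetherian local ring, the only case
in which it is used, the Krull dimension is finite, so that no information is lost. -/
noncomputable def dimNat (R : Type*) [CommRing R] : ℕ :=
  ((ringKrullDim R).unbotD 0).toNat

/-- The Frobenius power `J^[q]`: the ideal generated by the `q`-th powers of the elements of `J`. -/
def frobeniusPower {R : Type*} [CommRing R] (J : Ideal R) (q : ℕ) : Ideal R :=
  Ideal.span {y | ∃ x ∈ J, y = x ^ q}

/-- The sequence `ℓ_R(M / (I ^ ⌈s p ^ e⌉ + J^[p ^ e]) M) / p ^ (e d)`, `d = dim R`, indexed by `e`. -/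
noncomputable def hSeq {R : Type*} [CommRing R] (p : ℕ) (s : ℝ) (I J : Ideal R)
    (M : Type*) [AddCommGroup M] [Module R M] (e : ℕ) : ℝ :=
  ((Module.length R
      (M ⧸ ((I ^ ⌈s * (p : ℝ) ^ e⌉₊ ⊔ frobeniusPower J (p ^ e)) • (⊤ : Submodule R M)))).toNat : ℝ)
    / (p : ℝ) ^ (e * dimNat R)

/-- The `h`-function `h_s(I, J; M)`, the limit of the sequence `hSeq`. -/
noncomputable def hFun {R : Type*} [CommRing R] (p : ℕ) (s : ℝ) (I J : Ideal R)
    (M : Type*) [AddCommGroup M] [Module R M] : ℝ :=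
  limUnder atTop (hSeq p s I J M)

/-- The normalizing factor `H_s(d) = ∑_{i = 0}^{⌊s⌋} (-1)^i / d! * binom(d, i) * (s - i)^d`. -/
noncomputable def normFactor (s : ℝ) (d : ℕ) : ℝ :=
  ∑ i ∈ Finset.range (⌊s⌋₊ + 1),
    (-1 : ℝ) ^ i / (d.factorial : ℝ) * (d.choose i : ℝ) * (s - (i : ℝ)) ^ d

/-- The `s`-multiplicity `e_s(I, J; M) = h_s(I, J; M) / H_s(dim R)`. -/
noncomputable def sMult {R : Type*} [CommRing R] (p : ℕ) (s : ℝ) (I J : Ideal R)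
    (M : Type*) [AddCommGroup M] [Module R M] : ℝ :=
  hFun p s I J M / normFactor s (dimNat R)

/-- The sequence whose limit is `h_s(R)`, for a local ring `R`. -/
noncomputable def hSeqLocal (R : Type*) [CommRing R] [IsLocalRing R] (p : ℕ) (s : ℝ) : ℕ → ℝ :=
  hSeq p s (IsLocalRing.maximalIdeal R) (IsLocalRing.maximalIdeal R) R

/-- `h_s(R) = h_s(𝔪, 𝔪; R)` for a local ring `(R, 𝔪)`. -/
noncomputable def hLocal (R : Type*) [CommRing R] [IsLocalRing R] (p : ℕ) (s : ℝ) : ℝ :=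
  hFun p s (IsLocalRing.maximalIdeal R) (IsLocalRing.maximalIdeal R) R

/-- `e_s(R) = e_s(𝔪, 𝔪; R)` for a local ring `(R, 𝔪)`. -/
noncomputable def sMultLocal (R : Type*) [CommRing R] [IsLocalRing R] (p : ℕ) (s : ℝ) : ℝ :=
  sMult p s (IsLocalRing.maximalIdeal R) (IsLocalRing.maximalIdeal R) R

/-- The amalgamated duplication `R ⋈ I = {(r, s) | s - r ∈ I}`, a subring of `R × R`. -/
def amalgDup {R : Type*} [CommRing R] (I : Ideal R) : Subring (R × R) where
  carrier := {x | x.2 - x.1 ∈ I}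
  zero_mem' := by simp
  one_mem' := by simp
  add_mem' {a b} ha hb := by
    have h : (a + b).2 - (a + b).1 = (a.2 - a.1) + (b.2 - b.1) := by
      simp only [Prod.snd_add, Prod.fst_add]; ring
    rw [Set.mem_ofPred_eq, h]
    exact I.add_mem ha hb
  neg_mem' {a} ha := by
    have h : (-a).2 - (-a).1 = -(a.2 - a.1) := by
      simp only [Prod.snd_neg, Prod.fst_neg]; ring
    rw [Set.mem_ofPred_eq, h]
    exact I.neg_mem ha
  mul_mem' {a b} ha hb := by
    have h : (a * b).2 - (a * b).1 = a.2 * (b.2 - b.1) + b.1 * (a.2 - a.1) := by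
      simp only [Prod.snd_mul, Prod.fst_mul]; ring
    rw [Set.mem_ofPred_eq, h]
    exact I.add_mem (I.mul_mem_left _ hb) (I.mul_mem_left _ ha)

/-- For a proper ideal `I` of a local ring `R`, the ring `R ⋈ I` is local. -/
theorem amalgDup_isLocalRing {R : Type*} [CommRing R] [IsLocalRing R] (I : Ideal R) (hI : I ≠ ⊤) :
    IsLocalRing (amalgDup I) := by
  let f : amalgDup I →+* R := (RingHom.fst R R).comp (amalgDup I).subtype
  have : IsLocalHom f := by
    refine ⟨fun x hx => ?_⟩
    obtain ⟨⟨r, s⟩, hrs⟩ := x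
    have hrs' : s - r ∈ I := hrs
    have hr : IsUnit r := hx
    have hs : IsUnit s := by
      by_contra hs
      have h1 : s ∈ IsLocalRing.maximalIdeal R := hs
      have h2 := (IsLocalRing.maximalIdeal R).sub_mem h1 (IsLocalRing.le_maximalIdeal hI hrs')
      rw [sub_sub_cancel] at h2
      exact h2 hr
    obtain ⟨a, ha⟩ := hr.exists_right_inv
    obtain ⟨b, hb⟩ := hs.exists_right_inv
    have hab : b - a ∈ I := by
      have h : b - a = -(a * b) * (s - r) := by
        linear_combination a * hb - b * ha
      rw [h]
      exact I.mul_mem_left _ hrs'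
    refine IsUnit.of_mul_eq_one (⟨(a, b), hab⟩ : amalgDup I) ?_
    exact Subtype.ext (Prod.ext ha hb)
  exact RingHom.domain_isLocalRing f

/-! Put d = dim R. The projections embed `R ⋈ I` in R × R, and multiplication by an element x of I
carries R × R back into `R ⋈ I`; both composites are multiplication by x. Prime avoidance gives such
an x with dim R/x < d (`exists_mem_ringKrullDim_quotient_span_le`). The cokernels are killed by x,
so they change the lengths only by O(p^(e(d-1))), uniformly in the exponent of the power of the
maximal ideal. Hence the lengths for `R ⋈ I` are asymptotically twice those for R
(`asympLe_sLength_amalgDup`). The two rings have the same dimension, so the normalizations agree.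

Most of the work is the existence of the limit for R
(`exists_tendsto_normLength_of_ringKrullDim_le`). Completing and extending the residue field to an
algebraic closure preserves all the lengths involved (`exists_residue_extension`). The new ring is a
quotient of a power series ring over its coefficient field, hence Noetherian, and its Frobenius is
finite.

Over such a ring A, the length of A at level e + j is that of the Frobenius pushforward of A at
level e, up to O(p^(e(d-1))). If A is a domain, the pushforward agrees with a free module up to
torsion, which gives an approximate linear recursion and hence a limit
(`exists_tendsto_of_approx_recursion`). In general, a high enough pushforward is killed by the
nilradical and agrees, up to lower-dimensional modules, with a direct sum of modules over the
domains A/P, P a minimal prime (`exists_tendsto_normLength`). -/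

/-- The length of `M / J M`. -/
noncomputable def quotLength (A M : Type*) [CommRing A] [AddCommGroup M] [Module A M]
    (J : Ideal A) : ℕ∞ :=
  Module.length A (M ⧸ (J • ⊤ : Submodule A M))

/-! ### Lengths of M/JM under maps, powers and change of rings. -/

section QuotLength

variable {A M N : Type*} [CommRing A] [AddCommGroup M] [Module A M] [AddCommGroup N] [Module A N]

lemma quotLength_anti {J J' : Ideal A} (h : J ≤ J') :
    quotLength A M J' ≤ quotLength A M J :=
  Module.length_le_of_surjective (Submodule.factor (Submodule.smul_mono_left h))
    (Submodule.factor_surjective _)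

/-- The reduction M/JM → N/JN of f has image no longer than M/JM and cokernel N/(im f + JN). Keeping
`Q` as a variable lets a caller present that cokernel in its own form. -/
lemma quotLength_le_of_range {J : Ideal A} (f : M →ₗ[A] N) (Q : Submodule A N)
    (hQ : LinearMap.range f ⊔ J • ⊤ ≤ Q) (hQ' : Q ≤ LinearMap.range f ⊔ J • ⊤) :
    quotLength A N J ≤ quotLength A M J + Module.length A (N ⧸ Q) := by
  obtain rfl : Q = LinearMap.range f ⊔ J • ⊤ := le_antisymm hQ' hQ
  let g : M ⧸ (J • ⊤ : Submodule A M) →ₗ[A] N ⧸ (J • ⊤ : Submodule A N) :=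
    Submodule.mapQ _ _ f (by
      rw [← Submodule.map_le_iff_le_comap, Submodule.map_smul'']
      exact Submodule.smul_mono le_rfl le_top)
  have h1 := Module.length_eq_add_of_exact (LinearMap.range g).subtype (LinearMap.range g).mkQ
    (Submodule.subtype_injective _) (Submodule.mkQ_surjective _)
    (LinearMap.exact_subtype_mkQ _)
  have h2 : Module.length A (LinearMap.range g) ≤ quotLength A M J :=
    Module.length_le_of_surjective g.rangeRestrict g.surjective_rangeRestrict
  let k : N ⧸ (LinearMap.range f ⊔ J • ⊤) →ₗ[A]
      (N ⧸ (J • ⊤ : Submodule A N)) ⧸ LinearMap.range g :=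
    Submodule.liftQ _ ((LinearMap.range g).mkQ ∘ₗ Submodule.mkQ _) (by
      rw [sup_le_iff]
      constructor
      · rintro _ ⟨m, rfl⟩
        simp only [LinearMap.mem_ker, LinearMap.comp_apply, Submodule.mkQ_apply,
          Submodule.Quotient.mk_eq_zero]
        exact ⟨Submodule.Quotient.mk m, rfl⟩
      · intro n hn
        have : Submodule.Quotient.mk (p := (J • ⊤ : Submodule A N)) n = 0 :=
          (Submodule.Quotient.mk_eq_zero _).2 hn
        simp [this])
  have hk : Function.Surjective k := by
    intro y
    obtain ⟨y, rfl⟩ := Submodule.mkQ_surjective _ y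
    obtain ⟨n, rfl⟩ := Submodule.mkQ_surjective _ y
    exact ⟨Submodule.Quotient.mk n, rfl⟩
  have h3 := Module.length_le_of_surjective k hk
  unfold quotLength at *
  rw [h1]
  exact add_le_add h2 h3

lemma quotLength_le_of_surjective (J : Ideal A) (f : M →ₗ[A] N) (hf : Function.Surjective f) :
    quotLength A N J ≤ quotLength A M J := by
  refine (quotLength_le_of_range f ⊤ le_top ?_).trans ?_
  · rw [LinearMap.range_eq_top.2 hf]; exact le_sup_left
  · rw [Module.length_eq_zero, add_zero]

lemma quotLength_le_add_quotient_range (J : Ideal A) (f : M →ₗ[A] N) :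
    quotLength A N J ≤ quotLength A M J + quotLength A (N ⧸ LinearMap.range f) J := by
  refine (quotLength_le_of_range f _ le_rfl le_rfl).trans ?_
  gcongr
  let k : (N ⧸ LinearMap.range f) ⧸ (J • ⊤ : Submodule A (N ⧸ LinearMap.range f)) →ₗ[A]
      N ⧸ (LinearMap.range f ⊔ J • ⊤) :=
    Submodule.liftQ _ (Submodule.factor (le_sup_left)) (by
      rw [Submodule.smul_le]
      intro r hr n _
      obtain ⟨n, rfl⟩ := Submodule.mkQ_surjective _ n
      rw [LinearMap.mem_ker, ← map_smul]
      refine (Submodule.Quotient.mk_eq_zero _).2 ?_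
      exact Submodule.mem_sup_right (Submodule.smul_mem_smul hr trivial))
  refine Module.length_le_of_surjective k fun y => ?_
  obtain ⟨n, rfl⟩ := Submodule.mkQ_surjective _ y
  exact ⟨Submodule.Quotient.mk (Submodule.Quotient.mk n), rfl⟩

lemma quotLength_pi {ι : Type*} [Fintype ι] (M : ι → Type*) [∀ i, AddCommGroup (M i)]
    [∀ i, Module A (M i)] (J : Ideal A) :
    quotLength A (Π i, M i) J = ∑ i, quotLength A (M i) J := by
  classical
  have h : (J • ⊤ : Submodule A (Π i, M i)) =
      Submodule.pi Set.univ fun i => (J • ⊤ : Submodule A (M i)) := by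
    apply le_antisymm
    · rw [Submodule.smul_le]
      intro r hr n _ i _
      exact Submodule.smul_mem_smul hr trivial
    · intro f hf
      rw [← Finset.univ_sum_single f]
      refine Submodule.sum_mem _ fun i _ => ?_
      have := Submodule.mem_map_of_mem (f := LinearMap.single A M i) (hf i trivial)
      rw [Submodule.map_smul''] at this
      exact Submodule.smul_mono le_rfl le_top this
  unfold quotLength
  rw [← Module.length_pi_of_fintype, h]
  exact (Submodule.quotientPi _).length_eq

lemma quotLength_fin (n : ℕ) (J : Ideal A) :
    quotLength A (Fin n → M) J = n * quotLength A M J := by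
  rw [quotLength_pi]; simp

/-- Multiplication by x induces M/J'M → M/JM with cokernel M/(J + x)M. -/
lemma quotLength_smul_mul (x : A) {J J' : Ideal A} (h : ∀ y ∈ J', x * y ∈ J) :
    quotLength A M J ≤ quotLength A M J' + quotLength A M (J ⊔ Ideal.span {x}) := by
  let f : M →ₗ[A] M := LinearMap.lsmul A M x
  let g : M ⧸ (J' • ⊤ : Submodule A M) →ₗ[A] M ⧸ (J • ⊤ : Submodule A M) :=
    Submodule.mapQ _ _ f (by
      rw [Submodule.smul_le]
      intro r hr n _
      simp only [Submodule.mem_comap, f, LinearMap.lsmul_apply, smul_smul]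
      exact Submodule.smul_mem_smul (h r hr) trivial)
  have h1 := Module.length_eq_add_of_exact (LinearMap.range g).subtype (LinearMap.range g).mkQ
    (Submodule.subtype_injective _) (Submodule.mkQ_surjective _)
    (LinearMap.exact_subtype_mkQ _)
  have h2 : Module.length A (LinearMap.range g) ≤ quotLength A M J' :=
    Module.length_le_of_surjective g.rangeRestrict g.surjective_rangeRestrict
  let k : M ⧸ ((J ⊔ Ideal.span {x}) • ⊤ : Submodule A M) →ₗ[A]
      (M ⧸ (J • ⊤ : Submodule A M)) ⧸ LinearMap.range g :=
    Submodule.liftQ _ ((LinearMap.range g).mkQ ∘ₗ Submodule.mkQ _) (by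
      rw [Submodule.sup_smul, sup_le_iff]
      constructor
      · intro n hn
        have : Submodule.Quotient.mk (p := (J • ⊤ : Submodule A M)) n = 0 :=
          (Submodule.Quotient.mk_eq_zero _).2 hn
        simp [this]
      · rw [Submodule.ideal_span_singleton_smul]
        rintro _ ⟨m, -, rfl⟩
        simp only [LinearMap.mem_ker, LinearMap.comp_apply, Submodule.mkQ_apply,
          Submodule.Quotient.mk_eq_zero]
        exact ⟨Submodule.Quotient.mk m, rfl⟩)
  have hk : Function.Surjective k := by
    intro y
    obtain ⟨y, rfl⟩ := Submodule.mkQ_surjective _ y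
    obtain ⟨n, rfl⟩ := Submodule.mkQ_surjective _ y
    exact ⟨Submodule.Quotient.mk n, rfl⟩
  have h3 := Module.length_le_of_surjective k hk
  unfold quotLength at *
  rw [h1]
  exact add_le_add h2 h3

lemma quotLength_sup_span_pow (J : Ideal A) (x : A) (n : ℕ) :
    quotLength A M (J ⊔ Ideal.span {x ^ n}) ≤ n * quotLength A M (J ⊔ Ideal.span {x}) := by
  induction n with
  | zero =>
    have : (⊤ : Ideal A) • (⊤ : Submodule A M) = ⊤ := Submodule.top_smul _
    have h0 : Subsingleton (M ⧸ ((⊤ : Ideal A) • ⊤ : Submodule A M)) := by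
      rw [this]; infer_instance
    rw [pow_zero, Ideal.span_singleton_one, sup_top_eq, quotLength, Module.length_eq_zero]
    simp
  | succ n ih =>
    have h : ∀ y ∈ J ⊔ Ideal.span {x ^ n}, x * y ∈ J ⊔ Ideal.span {x ^ (n + 1)} := by
      intro y hy
      obtain ⟨a, ha, b, hb, rfl⟩ := Submodule.mem_sup.1 hy
      obtain ⟨c, rfl⟩ := Ideal.mem_span_singleton'.1 hb
      rw [mul_add]
      refine add_mem (Ideal.mem_sup_left (J.mul_mem_left _ ha)) (Ideal.mem_sup_right ?_)
      exact Ideal.mem_span_singleton'.2 ⟨c, by ring⟩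
    refine (quotLength_smul_mul (M := M) x h).trans ?_
    push_cast
    rw [add_mul, one_mul]
    gcongr
    refine quotLength_anti ?_
    gcongr
    exact le_sup_left

/-- The variables are replaced by their q-th powers one at a time, each costing a factor q. This is
the source of every bound of order p^(δe). -/
lemma quotLength_span_range_pow {δ : ℕ} (K : Ideal A) (x : Fin δ → A) (q : ℕ) :
    quotLength A M (K ⊔ Ideal.span (Set.range fun i => x i ^ q)) ≤
      (q ^ δ : ℕ) * quotLength A M (K ⊔ Ideal.span (Set.range x)) := by
  induction δ generalizing K with
  | zero => simp [Set.range_eq_empty]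
  | succ δ ih =>
    have key : ∀ y : Fin (δ + 1) → A, K ⊔ Ideal.span (Set.range y) =
        (K ⊔ Ideal.span {y 0}) ⊔ Ideal.span (Set.range fun i : Fin δ => y i.succ) := by
      intro y
      rw [sup_assoc, ← Ideal.span_union]
      congr 2
      rw [Fin.range_fin_succ, Set.singleton_union]; rfl
    rw [key, key x]
    refine (ih (K ⊔ Ideal.span {x 0 ^ q}) (fun i => x i.succ)).trans ?_
    rw [sup_right_comm]
    calc _ ≤ ((q ^ δ : ℕ) : ℕ∞) * (q * _) := by
            gcongr; exact quotLength_sup_span_pow _ _ _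
      _ = _ := by rw [← mul_assoc, ← Nat.cast_mul, ← pow_succ, sup_right_comm]

lemma quotLength_of_surjective {B : Type*} [CommRing B] [Algebra B A] [Module B M]
    [IsScalarTower B A M] (h : Function.Surjective (algebraMap B A)) (J : Ideal B) :
    quotLength B M J = quotLength A M (J.map (algebraMap B A)) := by
  have e : (J • ⊤ : Submodule B M) =
      ((J.map (algebraMap B A)) • ⊤ : Submodule A M).restrictScalars B := by
    exact (Ideal.smul_restrictScalars J (⊤ : Submodule A M)).symm
  unfold quotLength
  rw [e, (Submodule.Quotient.restrictScalarsEquiv B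
    ((J.map (algebraMap B A)) • ⊤ : Submodule A M)).length_eq]
  exact Module.length_eq_of_surjective h

lemma quotLength_sup_annihilator (J 𝔠 : Ideal A) (h : ∀ c ∈ 𝔠, ∀ m : M, c • m = 0) :
    quotLength A M (𝔠 ⊔ J) = quotLength A M J := by
  unfold quotLength
  have : (𝔠 • ⊤ : Submodule A M) = ⊥ := by
    rw [eq_bot_iff, Submodule.smul_le]
    intro c hc m _
    simp [h c hc m]
  rw [Submodule.sup_smul, this, bot_sup_eq]

end QuotLength

/-! ### Systems of parameters and Krull dimension. -/

section Param

variable {A : Type*} [CommRing A] [IsLocalRing A]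

open IsLocalRing

/-- `δ` elements of the maximal ideal which together with `𝔠` generate a primary ideal. -/
def IsParam (𝔠 : Ideal A) (δ : ℕ) : Prop :=
  ∃ x : Fin δ → A, (∀ i, x i ∈ maximalIdeal A) ∧
    ∃ t, maximalIdeal A ^ t ≤ 𝔠 ⊔ Ideal.span (Set.range x)

lemma IsParam.exists_succ {𝔠 : Ideal A} {δ : ℕ} (h : IsParam 𝔠 (δ + 1)) :
    ∃ x ∈ maximalIdeal A, IsParam (𝔠 ⊔ Ideal.span {x}) δ := by
  obtain ⟨x, hx, t, ht⟩ := h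
  refine ⟨x 0, hx 0, fun i => x i.succ, fun i => hx _, t, ht.trans_eq ?_⟩
  rw [sup_assoc, ← Ideal.span_union]
  congr 2
  rw [Fin.range_fin_succ, Set.singleton_union]; rfl

/-- A family with fewer than δ members is padded with zeros. -/
lemma isParam_of_finset {𝔠 : Ideal A} {δ : ℕ} (s : Finset A) (hs : s.card ≤ δ)
    (hsm : ∀ x ∈ s, x ∈ maximalIdeal A) {t : ℕ}
    (ht : maximalIdeal A ^ t ≤ 𝔠 ⊔ Ideal.span (s : Set A)) : IsParam 𝔠 δ := by
  let x : Fin δ → A := fun i => if h : (i : ℕ) < s.card then s.equivFin.symm ⟨i, h⟩ else 0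
  refine ⟨x, fun i => ?_, t, ht.trans (sup_le_sup_left (Ideal.span_mono ?_) _)⟩
  · simp only [x]
    split_ifs with h
    · exact hsm _ (s.equivFin.symm ⟨i, h⟩).2
    · exact zero_mem _
  · intro a ha
    refine ⟨⟨s.equivFin ⟨a, ha⟩, (s.equivFin ⟨a, ha⟩).2.trans_le hs⟩, ?_⟩
    simp [x]

variable [IsNoetherianRing A]

/-- The maximal ideal of A/𝔠 is minimal over an ideal with as many generators as its height. It is
then the only prime over that ideal, which therefore contains a power of it; the generators are
lifted to A. -/
lemma isParam_of_ringKrullDim_le {𝔠 : Ideal A} {δ : ℕ} (h : ringKrullDim (A ⧸ 𝔠) ≤ δ) :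
    IsParam 𝔠 δ := by
  classical
  by_cases hc : 𝔠 = ⊤
  · exact ⟨fun _ => 0, fun _ => zero_mem _, 0, by simp [hc]⟩
  have := Ideal.Quotient.nontrivial_iff.2 hc
  have : IsLocalRing (A ⧸ 𝔠) := .of_surjective' (Ideal.Quotient.mk 𝔠) Ideal.Quotient.mk_surjective
  obtain ⟨s, hs, hcard⟩ :=
    Ideal.exists_finset_card_eq_height_of_isNoetherianRing (maximalIdeal (A ⧸ 𝔠))
  have hle : s.card ≤ δ := by
    have h1 := (maximalIdeal_height_eq_ringKrullDim (R := A ⧸ 𝔠)).trans_le h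
    rw [← hcard] at h1
    exact_mod_cast h1
  have hmap : (maximalIdeal A).map (Ideal.Quotient.mk 𝔠) = maximalIdeal (A ⧸ 𝔠) :=
    IsLocalRing.map_maximalIdeal_of_surjective _ Ideal.Quotient.mk_surjective
  have hrad : maximalIdeal (A ⧸ 𝔠) ≤ (Ideal.span (s : Set (A ⧸ 𝔠))).radical := by
    rw [Ideal.radical_eq_sInf]
    refine le_sInf fun P hP => ?_
    have := hP.2
    exact hs.2 ⟨hP.2, hP.1⟩ (le_maximalIdeal hP.2.ne_top)
  obtain ⟨t, ht⟩ := Ideal.exists_pow_le_of_le_radical_of_fg hrad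
    (IsNoetherian.noetherian _)
  obtain ⟨g, hg⟩ := (Ideal.Quotient.mk_surjective (I := 𝔠)).hasRightInverse
  refine isParam_of_finset (t := t) (s.image g) (Finset.card_image_le.trans hle) ?_ ?_
  · intro x hx
    obtain ⟨y, hy, rfl⟩ := Finset.mem_image.1 hx
    have : y ∈ maximalIdeal (A ⧸ 𝔠) := hs.1.2 (Ideal.subset_span hy)
    rw [← hg y] at this
    exact fun hu => this (hu.map (Ideal.Quotient.mk 𝔠))
  · rw [← hmap, ← Ideal.map_pow, Ideal.map_le_iff_le_comap] at ht
    refine ht.trans fun y hy => ?_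
    have e : Ideal.span (s : Set (A ⧸ 𝔠)) =
        (Ideal.span ((s.image g : Finset A) : Set A)).map (Ideal.Quotient.mk 𝔠) := by
      rw [Ideal.map_span, Finset.coe_image, ← Set.image_comp]
      congr 1
      ext z
      constructor
      · intro hz; exact ⟨z, hz, hg z⟩
      · rintro ⟨w, hw, rfl⟩; simpa [hg w] using hw
    rw [Ideal.mem_comap, e] at hy
    obtain ⟨w, hw, hwy⟩ := (Ideal.mem_map_iff_of_surjective _ Ideal.Quotient.mk_surjective).1 hy
    have h1 : y - w ∈ 𝔠 := Ideal.Quotient.eq.1 hwy.symm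
    rw [← sub_add_cancel y w]
    exact add_mem (Ideal.mem_sup_left h1) (Ideal.mem_sup_right hw)

/-- This is Krull's height theorem: the maximal ideal is minimal over the ideal of the parameters.
-/
lemma IsParam.ringKrullDim_le {δ : ℕ} (h : IsParam (⊥ : Ideal A) δ) : ringKrullDim A ≤ δ := by
  classical
  obtain ⟨x, hx, t, ht⟩ := h
  rw [bot_sup_eq] at ht
  have hmin : maximalIdeal A ∈ (Ideal.span (Set.range x)).minimalPrimes := by
    refine ⟨⟨inferInstance, Ideal.span_le.2 (by rintro _ ⟨i, rfl⟩; exact hx i)⟩, ?_⟩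
    rintro P ⟨hP, hPx⟩ _
    exact hP.le_of_pow_le (ht.trans hPx)
  have h1 := Ideal.height_le_card_of_mem_minimalPrimes_span (Set.finite_range x) hmin
  rw [← maximalIdeal_height_eq_ringKrullDim]
  have h2 : (Set.range x).ncard ≤ δ := by
    rw [← Set.image_univ]
    refine (Set.ncard_image_le Set.finite_univ).trans ?_
    simp
  have h3 : (maximalIdeal A).height ≤ (δ : ℕ∞) := h1.trans (by exact_mod_cast h2)
  exact_mod_cast h3

lemma quotLength_pow_maximalIdeal_ne_top {M : Type*} [AddCommGroup M] [Module A M]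
    [Module.Finite A M] (t : ℕ) : quotLength A M (maximalIdeal A ^ t) ≠ ⊤ := by
  obtain ⟨n, f, hf⟩ := Module.Finite.exists_fin' A M
  refine ne_top_of_le_ne_top ?_ (quotLength_le_of_surjective _ f hf)
  rw [quotLength_fin]
  refine WithTop.mul_ne_top (ENat.natCast_ne_top n) ?_
  unfold quotLength
  have e : (maximalIdeal A ^ t • ⊤ : Submodule A A) = maximalIdeal A ^ t := by simp
  rw [e, Module.length_eq_of_surjective (R := A ⧸ maximalIdeal A ^ t)
    Ideal.Quotient.mk_surjective]
  have : IsArtinianRing (A ⧸ maximalIdeal A ^ t) := by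
    rcases eq_or_ne t 0 with rfl | h0
    · have : Subsingleton (A ⧸ maximalIdeal A ^ 0) :=
        Ideal.Quotient.subsingleton_iff.2 (by simp)
      infer_instance
    · have hne : maximalIdeal A ^ t ≠ ⊤ := fun h =>
        (maximalIdeal.isMaximal A).ne_top (top_le_iff.1 (h ▸ Ideal.pow_le_self h0))
      have := Ideal.Quotient.nontrivial_iff.2 hne
      have hl : IsLocalRing (A ⧸ maximalIdeal A ^ t) :=
        .of_surjective' (Ideal.Quotient.mk _) Ideal.Quotient.mk_surjective
      have hmap : (maximalIdeal A).map (Ideal.Quotient.mk (maximalIdeal A ^ t)) =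
          maximalIdeal (A ⧸ maximalIdeal A ^ t) :=
        IsLocalRing.map_maximalIdeal_of_surjective _ Ideal.Quotient.mk_surjective
      refine isArtinianRing_iff_isNilpotent_maximalIdeal _ |>.2 ⟨t, ?_⟩
      rw [← hmap, ← Ideal.map_pow, Ideal.map_quotient_self]; rfl
  exact Module.length_ne_top

end Param

open IsLocalRing

/-! ### Frobenius powers compared with ordinary powers. -/

section FrobeniusPower

lemma frobeniusPower_eq_map {A : Type*} [CommRing A] (p : ℕ) [ExpChar A p] (J : Ideal A) (e : ℕ) :
    frobeniusPower J (p ^ e) = J.map (iterateFrobenius A p e) := by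
  unfold frobeniusPower Ideal.map
  congr 1
  ext y
  simp only [Set.mem_image, SetLike.mem_coe, iterateFrobenius_def, Set.mem_ofPred_eq]
  exact ⟨fun ⟨x, hx, h⟩ => ⟨x, hx, h.symm⟩, fun ⟨x, hx, h⟩ => ⟨x, hx, h.symm⟩⟩

lemma map_frobeniusPower {A B : Type*} [CommRing A] [CommRing B] (p : ℕ) [ExpChar A p]
    [ExpChar B p] (f : A →+* B) (J : Ideal A) (e : ℕ) :
    (frobeniusPower J (p ^ e)).map f = frobeniusPower (J.map f) (p ^ e) := by
  rw [frobeniusPower_eq_map, frobeniusPower_eq_map, Ideal.map_map, Ideal.map_map,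
    RingHom.iterateFrobenius_comm]

lemma pow_mem_frobeniusPower {A : Type*} [CommRing A] {J : Ideal A} {x : A} (hx : x ∈ J) (q : ℕ) :
    x ^ q ∈ frobeniusPower J q :=
  Ideal.subset_span ⟨x, hx, rfl⟩

/-- Divide each exponent by Q with remainder. The remainders total at most nQ, so the quotients add
up to at least N. -/
lemma prod_pow_mem_span_pow {A : Type*} [CommRing A] {n : ℕ} (y : Fin n → A) {Q N : ℕ}
    (hQ : 0 < Q) (α : Fin n → ℕ) (h : ∑ k, α k = Q * N + n * Q) :
    ∏ k, y k ^ α k ∈ Ideal.span (Set.range fun i => y i ^ Q) ^ N := by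
  have e1 : ∏ k, y k ^ α k = (∏ k, (y k ^ Q) ^ (α k / Q)) * ∏ k, y k ^ (α k % Q) := by
    rw [← Finset.prod_mul_distrib]
    refine Finset.prod_congr rfl fun k _ => ?_
    rw [← pow_mul, ← pow_add, Nat.div_add_mod]
  have e2 : N ≤ ∑ k, α k / Q := by
    have h1 : ∑ k, α k = Q * ∑ k, α k / Q + ∑ k, α k % Q := by
      rw [Finset.mul_sum, ← Finset.sum_add_distrib]
      exact Finset.sum_congr rfl fun k _ => (Nat.div_add_mod _ _).symm
    have h2 : ∑ k, α k % Q ≤ n * Q := by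
      refine (Finset.sum_le_card_nsmul _ _ Q fun k _ => (Nat.mod_lt _ hQ).le).trans ?_
      simp
    refine Nat.le_of_mul_le_mul_left ?_ hQ
    omega
  rw [e1]
  refine Ideal.mul_mem_right _ _ (Ideal.pow_le_pow_right e2 ?_)
  rw [← Finset.prod_pow_eq_pow_sum]
  exact Ideal.prod_mem_prod fun k _ => Ideal.pow_mem_pow (Ideal.subset_span (Set.mem_range_self k)) _

lemma span_range_pow_add_le {A : Type*} [CommRing A] {n : ℕ} (y : Fin n → A) (Q N : ℕ)
    (hQ : 0 < Q) :
    Ideal.span (Set.range y) ^ (Q * N + n * Q) ≤ Ideal.span (Set.range fun i => y i ^ Q) ^ N := by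
  classical
  have h0 := Submodule.span_pow (R := A) (Set.range y) (Q * N + n * Q)
  rw [show Ideal.span (Set.range y) ^ (Q * N + n * Q) = _ from h0, Submodule.span_le]
  intro a ha
  obtain ⟨f, hf, rfl⟩ := Set.mem_pow_iff_prod.1 ha
  choose g hg using hf
  have e1 : ∏ i, f i = ∏ k, y k ^ (Finset.univ.filter fun i => g i = k).card := by
    simp_rw [← hg]
    exact Finset.prod_comp y g |>.trans (Finset.prod_subset (Finset.subset_univ _) (by
      intro k _ hk
      rw [Finset.filter_eq_empty_iff.2, Finset.card_empty, pow_zero]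
      intro i _ h
      exact hk (Finset.mem_image.2 ⟨i, Finset.mem_univ _, h⟩)))
  have e2 : ∑ k, (Finset.univ.filter fun i => g i = k).card = Q * N + n * Q := by
    rw [← Finset.card_eq_sum_card_fiberwise (fun _ _ => Finset.mem_coe.2 (Finset.mem_univ _))]
    simp
  rw [e1]
  exact prod_pow_mem_span_pow y hQ _ e2

end FrobeniusPower

/-! ### Lengths modulo 𝔪^a + 𝔪^[p^e], up to O(p^(δe)). -/

section SLength

/-- The ideal `𝔪 ^ a + 𝔪 ^ [p ^ e]` of a local ring. -/
def sIdeal (A : Type*) [CommRing A] [IsLocalRing A] (p a e : ℕ) : Ideal A :=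
  maximalIdeal A ^ a ⊔ frobeniusPower (maximalIdeal A) (p ^ e)

/-- The length of `M / (𝔪 ^ a + 𝔪 ^ [p ^ e]) M`. -/
noncomputable def sLength (A M : Type*) [CommRing A] [IsLocalRing A] [AddCommGroup M] [Module A M]
    (p a e : ℕ) : ℕ∞ :=
  quotLength A M (sIdeal A p a e)

/-- `u ≤ v + O(p ^ (δ e))`, uniformly in the first variable. -/
def AsympLe (p δ : ℕ) (u v : ℕ → ℕ → ℕ∞) : Prop :=
  ∃ C : ℕ, ∀ a e, u a e ≤ v a e + ((C * p ^ (δ * e) : ℕ) : ℕ∞)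

variable {p δ : ℕ}

lemma AsympLe.trans {u v w : ℕ → ℕ → ℕ∞} (h : AsympLe p δ u v) (h' : AsympLe p δ v w) :
    AsympLe p δ u w := by
  obtain ⟨C, hC⟩ := h
  obtain ⟨C', hC'⟩ := h'
  refine ⟨C' + C, fun a e => (hC a e).trans ?_⟩
  rw [add_mul, Nat.cast_add, ← add_assoc]
  gcongr
  exact hC' a e

lemma AsympLe.sum {ι : Type*} [Fintype ι] {u v : ι → ℕ → ℕ → ℕ∞}
    (h : ∀ i, AsympLe p δ (u i) (v i)) :
    AsympLe p δ (fun a e => ∑ i, u i a e) (fun a e => ∑ i, v i a e) := by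
  choose C hC using h
  refine ⟨∑ i, C i, fun a e => ?_⟩
  rw [Finset.sum_mul, Nat.cast_sum, ← Finset.sum_add_distrib]
  exact Finset.sum_le_sum fun i _ => hC i a e

variable {A M N : Type*} [CommRing A] [IsLocalRing A] [AddCommGroup M] [Module A M]
  [AddCommGroup N] [Module A N]

lemma sLength_pi {ι : Type*} [Fintype ι] (M : ι → Type*) [∀ i, AddCommGroup (M i)]
    [∀ i, Module A (M i)] (a e : ℕ) :
    sLength A (Π i, M i) p a e = ∑ i, sLength A (M i) p a e :=
  quotLength_pi M _

lemma sLength_fin (n a e : ℕ) : sLength A (Fin n → M) p a e = n * sLength A M p a e :=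
  quotLength_fin n _

lemma sIdeal_map_of_surjective {B : Type*} [CommRing B] [IsLocalRing B] [ExpChar A p]
    [ExpChar B p] (f : A →+* B) (hf : Function.Surjective f) (a e : ℕ) :
    (sIdeal A p a e).map f = sIdeal B p a e := by
  rw [sIdeal, sIdeal, Ideal.map_sup, Ideal.map_pow, map_frobeniusPower,
    map_maximalIdeal_of_surjective f hf]

lemma sLength_of_surjective {B : Type*} [CommRing B] [IsLocalRing B] [ExpChar A p]
    [ExpChar B p] [Algebra A B] [Module B M] [IsScalarTower A B M]
    (hf : Function.Surjective (algebraMap A B)) (a e : ℕ) :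
    sLength A M p a e = sLength B M p a e := by
  rw [sLength, sLength, quotLength_of_surjective hf, sIdeal_map_of_surjective _ hf]

/-- The p^e-th powers of the parameters already lie in 𝔪^[p^e], so the bound does not depend on a.
-/
lemma exists_quotLength_sup_sIdeal_le [IsNoetherianRing A] (M : Type*) [AddCommGroup M]
    [Module A M] [Module.Finite A M] (p : ℕ) (𝔠 : Ideal A) (h : IsParam 𝔠 δ) :
    ∃ C : ℕ, ∀ a e, quotLength A M (𝔠 ⊔ sIdeal A p a e) ≤ ((C * p ^ (δ * e) : ℕ) : ℕ∞) := by
  obtain ⟨x, hx, t, ht⟩ := h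
  have hfin : quotLength A M (𝔠 ⊔ Ideal.span (Set.range x)) ≠ ⊤ :=
    ne_top_of_le_ne_top (quotLength_pow_maximalIdeal_ne_top t) (quotLength_anti ht)
  obtain ⟨C, hC⟩ := ENat.ne_top_iff_exists.1 hfin
  refine ⟨C, fun a e => ?_⟩
  have h1 : 𝔠 ⊔ Ideal.span (Set.range fun i => x i ^ p ^ e) ≤ 𝔠 ⊔ sIdeal A p a e := by
    refine sup_le_sup_left (le_trans (Ideal.span_le.2 ?_) le_sup_right) _
    rintro _ ⟨i, rfl⟩
    exact pow_mem_frobeniusPower (hx i) _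
  refine (quotLength_anti h1).trans ((quotLength_span_range_pow 𝔠 x (p ^ e)).trans ?_)
  rw [← hC, ← Nat.cast_mul, mul_comm δ, pow_mul, mul_comm C]

lemma exists_sLength_le [IsNoetherianRing A] [Module.Finite A M] (p : ℕ) (𝔠 : Ideal A)
    (h𝔠 : ∀ c ∈ 𝔠, ∀ m : M, c • m = 0) (h : IsParam 𝔠 δ) :
    ∃ C : ℕ, ∀ a e, sLength A M p a e ≤ ((C * p ^ (δ * e) : ℕ) : ℕ∞) := by
  obtain ⟨C, hC⟩ := exists_quotLength_sup_sIdeal_le M p 𝔠 h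
  refine ⟨C, fun a e => ?_⟩
  rw [sLength, ← quotLength_sup_annihilator _ 𝔠 h𝔠]
  exact hC a e

/-- Only the cokernel of f matters for this inequality, and it is killed by c, so its length is
O(p^(δe)). -/
lemma asympLe_of_range [IsNoetherianRing A] [Module.Finite A N] (p : ℕ) {c : A}
    (h : IsParam (Ideal.span {c}) δ) (f : M →ₗ[A] N) (hf : ∀ n : N, c • n ∈ LinearMap.range f) :
    AsympLe p δ (sLength A N p) (sLength A M p) := by
  obtain ⟨C, hC⟩ := exists_sLength_le (M := N ⧸ LinearMap.range f) p (Ideal.span {c})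
    (fun b hb m => by
      obtain ⟨b, rfl⟩ := Ideal.mem_span_singleton'.1 hb
      obtain ⟨m, rfl⟩ := Submodule.mkQ_surjective _ m
      rw [← map_smul, Submodule.mkQ_apply, Submodule.Quotient.mk_eq_zero, mul_smul]
      exact Submodule.smul_mem _ _ (hf m)) h
  exact ⟨C, fun a e => (quotLength_le_add_quotient_range _ f).trans (add_le_add le_rfl (hC a e))⟩

/-- Raising a by one is controlled by multiplication by a parameter x: it maps 𝔪^a into 𝔪^(a+1), and
the cokernel is killed by x. Thus a bounded change of a is negligible. -/
lemma exists_sLength_add_le [IsNoetherianRing A] [Module.Finite A M] (p : ℕ)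
    (h : IsParam (⊥ : Ideal A) (δ + 1)) :
    ∃ C : ℕ, ∀ k a e, sLength A M p (a + k) e ≤
      sLength A M p a e + ((k * (C * p ^ (δ * e)) : ℕ) : ℕ∞) := by
  obtain ⟨x, hx, hxp⟩ := h.exists_succ
  rw [bot_sup_eq] at hxp
  obtain ⟨C, hC⟩ := exists_quotLength_sup_sIdeal_le M p _ hxp
  have key : ∀ a e, sLength A M p (a + 1) e ≤
      sLength A M p a e + ((C * p ^ (δ * e) : ℕ) : ℕ∞) := by
    intro a e
    refine (quotLength_smul_mul (M := M) x (J' := sIdeal A p a e) ?_).trans ?_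
    · intro y hy
      obtain ⟨b, hb, c, hc, rfl⟩ := Submodule.mem_sup.1 hy
      rw [mul_add]
      refine add_mem (Ideal.mem_sup_left ?_) (Ideal.mem_sup_right (Ideal.mul_mem_left _ _ hc))
      rw [pow_succ']
      exact Ideal.mul_mem_mul hx hb
    · refine add_le_add le_rfl (le_trans ?_ (hC (a + 1) e))
      exact (congrArg _ (sup_comm _ _)).le
  refine ⟨C, fun k => ?_⟩
  induction k with
  | zero => intro a e; simp
  | succ k ih =>
    intro a e
    refine (key (a + k) e).trans ?_
    rw [add_mul, one_mul, Nat.cast_add, ← add_assoc]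
    gcongr
    exact ih a e

end SLength

/-! ### The Frobenius pushforward over a ring with perfect residue field. -/

section FrobeniusTwist

/-- The ring `A`, regarded as an `A`-algebra through the `j`-th iterate of Frobenius. -/
def FrobeniusTwist (A : Type*) (_p _j : ℕ) : Type _ := A

namespace FrobeniusTwist

variable (A : Type*) [CommRing A] (p j : ℕ)

instance : CommRing (FrobeniusTwist A p j) := inferInstanceAs (CommRing A)

instance [IsLocalRing A] : IsLocalRing (FrobeniusTwist A p j) := inferInstanceAs (IsLocalRing A)

instance [IsDomain A] : IsDomain (FrobeniusTwist A p j) := inferInstanceAs (IsDomain A)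

noncomputable instance [ExpChar A p] : Algebra A (FrobeniusTwist A p j) :=
  (iterateFrobenius A p j).toAlgebra

/-- The identity map from the twist to the ring. -/
def toBase : FrobeniusTwist A p j ≃+* A := RingEquiv.refl A

variable {A p j}

lemma toBase_smul [ExpChar A p] (a : A) (b : FrobeniusTwist A p j) :
    toBase A p j (a • b) = a ^ p ^ j * toBase A p j b := rfl

instance [ExpChar A p] [IsLocalRing A] [Fact p.Prime] :
    IsLocalHom (algebraMap A (FrobeniusTwist A p j)) := by
  refine ⟨fun a ha => ?_⟩
  have h : IsUnit (a ^ p ^ j) := ha.map (toBase A p j)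
  exact (isUnit_pow_iff (pow_ne_zero _ (Fact.out : p.Prime).ne_zero)).1 h

lemma exists_sub_pow_mem [ExpChar A p] [IsLocalRing A]
    (h : ∀ b : A, ∃ a, b - a ^ p ∈ maximalIdeal A) (j : ℕ) (b : A) :
    ∃ a, b - a ^ p ^ j ∈ maximalIdeal A := by
  induction j generalizing b with
  | zero => exact ⟨b, by simp⟩
  | succ j ih =>
    obtain ⟨a, ha⟩ := h b
    obtain ⟨c, hc⟩ := ih a
    refine ⟨c, ?_⟩
    have : b - c ^ p ^ (j + 1) = (b - a ^ p) + (a - c ^ p ^ j) ^ p := by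
      rw [sub_pow_expChar, ← pow_mul, pow_succ]; ring
    rw [this]
    exact add_mem ha (Ideal.pow_mem_of_mem _ hc _ (expChar_pos A p))

/-- The hypothesis `h` makes the residue field perfect, so the extension of residue fields under
iterated Frobenius has degree one. -/
lemma length_restrictScalars [ExpChar A p] [Fact p.Prime] [IsLocalRing A]
    (h : ∀ b : A, ∃ a, b - a ^ p ∈ maximalIdeal A) (M : Type*) [AddCommGroup M] [Module A M]
    [Module (FrobeniusTwist A p j) M] [IsScalarTower A (FrobeniusTwist A p j) M] :
    Module.length A M = Module.length (FrobeniusTwist A p j) M := by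
  have h1 : Module.length (ResidueField A) (ResidueField (FrobeniusTwist A p j)) = 1 := by
    rw [Module.length_eq_of_surjective (R := ResidueField (FrobeniusTwist A p j)),
      Module.length_eq_one]
    intro x
    obtain ⟨b, rfl⟩ := residue_surjective x
    obtain ⟨a, ha⟩ := exists_sub_pow_mem h j (toBase A p j b)
    refine ⟨residue A a, ?_⟩
    change residue _ (algebraMap A (FrobeniusTwist A p j) a) = residue _ b
    refine (Ideal.Quotient.eq.2 ?_).symm
    exact ha
  rw [IsLocalRing.length_restrictScalars A (FrobeniusTwist A p j) M, h1, mul_one]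

lemma quotLength_eq [ExpChar A p] [Fact p.Prime] [IsLocalRing A]
    (h : ∀ b : A, ∃ a, b - a ^ p ∈ maximalIdeal A) (J : Ideal A) :
    quotLength A (FrobeniusTwist A p j) J = quotLength A A (J.map (iterateFrobenius A p j)) := by
  have e1 : (J • ⊤ : Submodule A (FrobeniusTwist A p j)) =
      (J.map (algebraMap A (FrobeniusTwist A p j))).restrictScalars A := Ideal.smul_top_eq_map J
  rw [quotLength, e1, (Submodule.Quotient.restrictScalarsEquiv A
    (J.map (algebraMap A (FrobeniusTwist A p j)))).length_eq, length_restrictScalars (j := j) h]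
  have e2 : ((J.map (iterateFrobenius A p j)) • ⊤ : Submodule A A) =
    J.map (iterateFrobenius A p j) := by simp
  rw [quotLength, e2]
  rfl

end FrobeniusTwist

variable {A : Type*} [CommRing A] [IsLocalRing A] {p : ℕ} [Fact p.Prime]
  [ExpChar A p]

lemma sLength_le_sLength_frobeniusTwist (h : ∀ b : A, ∃ a, b - a ^ p ∈ maximalIdeal A)
    (j a e : ℕ) :
    sLength A A p (p ^ j * a) (e + j) ≤ sLength A (FrobeniusTwist A p j) p a e := by
  rw [sLength, sLength, FrobeniusTwist.quotLength_eq h]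
  refine quotLength_anti ?_
  rw [sIdeal, Ideal.map_sup]
  refine sup_le_sup ?_ ?_
  · rw [Ideal.map_pow, pow_mul]
    refine Ideal.pow_right_mono ?_ a
    rw [Ideal.map_le_iff_le_comap]
    intro x hx
    rw [Ideal.mem_comap, iterateFrobenius_def]
    exact Ideal.pow_mem_pow hx _
  · rw [frobeniusPower_eq_map, frobeniusPower_eq_map, Ideal.map_map, add_comm e,
      iterateFrobenius_add]

/-- With n generators of 𝔪, the power 𝔪^(p^j a + n p^j) lies in (𝔪^[p^j])^a, so the slack c = n p^j
is independent of a and e. -/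
lemma exists_sLength_frobeniusTwist_le [IsNoetherianRing A]
    (h : ∀ b : A, ∃ a, b - a ^ p ∈ maximalIdeal A) (j : ℕ) :
    ∃ c : ℕ, ∀ a e, sLength A (FrobeniusTwist A p j) p a e ≤
      sLength A A p (p ^ j * a + c) (e + j) := by
  obtain ⟨n, y, hy⟩ := Submodule.fg_iff_exists_fin_generating_family.1
    (IsNoetherian.noetherian (maximalIdeal A))
  refine ⟨n * p ^ j, fun a e => ?_⟩
  rw [sLength, sLength, FrobeniusTwist.quotLength_eq h]
  refine quotLength_anti ?_
  rw [sIdeal, sIdeal, Ideal.map_sup]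
  refine sup_le_sup ?_ ?_
  · have h1 := span_range_pow_add_le y (p ^ j) a (pow_pos (Fact.out : p.Prime).pos j)
    have hy' : Ideal.span (Set.range y) = maximalIdeal A := hy
    rw [hy'] at h1
    refine h1.trans ?_
    rw [Ideal.map_pow]
    refine Ideal.pow_right_mono (Ideal.span_le.2 ?_) a
    rintro _ ⟨i, rfl⟩
    exact Ideal.mem_map_of_mem (iterateFrobenius A p j)
      (hy ▸ Ideal.subset_span ⟨i, rfl⟩ : y i ∈ maximalIdeal A)
  · rw [frobeniusPower_eq_map, frobeniusPower_eq_map, Ideal.map_map, add_comm e,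
      iterateFrobenius_add]

end FrobeniusTwist

/-! ### Approximate recursions and the limit for domains. -/

/-- For ρ = 1 the sequence is Cauchy. For ρ < 1 the errors are damped and g tends to 0. For ρ > 1
the recursion is run backwards: boundedness forces |g e| ≤ C/(ρ-1) · q^e. Treating all ρ makes it
unnecessary to compute the rank of the Frobenius pushforward. -/
lemma exists_tendsto_of_approx_recursion {g : ℕ → ℝ} {ρ q C G : ℝ} (hρ : 0 ≤ ρ) (hq : 0 < q)
    (hq1 : q < 1) (hG : ∀ e, |g e| ≤ G) (h : ∀ e, |g (e + 1) - ρ * g e| ≤ C * q ^ e) :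
    ∃ L, Tendsto g atTop (𝓝 L) := by
  have hC : 0 ≤ C := by simpa using (abs_nonneg _).trans (h 0)
  have hG0 : 0 ≤ G := (abs_nonneg _).trans (hG 0)
  rcases lt_trichotomy ρ 1 with hρ1 | rfl | hρ1
  · obtain ⟨σ, hσ, hσ1⟩ := exists_between (max_lt hρ1 hq1)
    have hρσ : ρ ≤ σ := (le_max_left _ _).trans hσ.le
    have hqσ : q ≤ σ := (le_max_right _ _).trans hσ.le
    have hσ0 : 0 < σ := hq.trans_le hqσ
    have key : ∀ e : ℕ, |g e| ≤ G * σ ^ e + C / σ * (e * σ ^ e) := by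
      intro e
      induction e with
      | zero => simpa using hG 0
      | succ e ih =>
        have h1 : |g (e + 1)| ≤ |g (e + 1) - ρ * g e| + ρ * |g e| := by
          calc |g (e + 1)| = |(g (e + 1) - ρ * g e) + ρ * g e| := by ring_nf
            _ ≤ _ := (abs_add_le _ _).trans_eq (by rw [abs_mul ρ, abs_of_nonneg hρ])
        have h2 : C * q ^ e ≤ C * σ ^ e := by gcongr
        have h3 : ρ * |g e| ≤ σ * (G * σ ^ e + C / σ * (e * σ ^ e)) := by gcongr
        have h4 : C / σ * ((e + 1 : ℕ) * σ ^ (e + 1)) =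
            σ * (C / σ * (e * σ ^ e)) + C * σ ^ e := by
          push_cast; field_simp; ring
        rw [h4, pow_succ]
        linarith [h e]
    refine ⟨0, squeeze_zero_norm key ?_⟩
    have t1 := (tendsto_pow_atTop_nhds_zero_of_lt_one hσ0.le hσ1).const_mul G
    have t2 := (tendsto_self_mul_const_pow_of_lt_one hσ0.le hσ1).const_mul (C / σ)
    simpa using t1.add t2
  · refine cauchySeq_tendsto_of_complete (cauchySeq_of_le_geometric q C hq1 fun e => ?_)
    rw [dist_comm, Real.dist_eq]
    simpa using h e
  · have hK : 0 ≤ C / (ρ - 1) := div_nonneg hC (by linarith)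
    have key : ∀ k e : ℕ, |g e| ≤ (ρ⁻¹) ^ k * G + C / (ρ - 1) * q ^ e := by
      intro k
      induction k with
      | zero => intro e; rw [pow_zero, one_mul]; exact (hG e).trans (by simp; positivity)
      | succ k ih =>
        intro e
        have h1 : ρ * |g e| ≤ |g (e + 1) - ρ * g e| + |g (e + 1)| := by
          calc ρ * |g e| = |-(g (e + 1) - ρ * g e) + g (e + 1)| := by
                rw [← abs_of_nonneg hρ, ← abs_mul, abs_of_nonneg hρ]; ring_nf
            _ ≤ _ := (abs_add_le _ _).trans_eq (by rw [abs_neg])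
        have h2 := ih (e + 1)
        have h3 : C / (ρ - 1) * q ^ (e + 1) ≤ C / (ρ - 1) * q ^ e := by
          gcongr ?_ * ?_
          exact pow_le_pow_of_le_one hq.le hq1.le (Nat.le_succ e)
        have h4 : C * q ^ e + C / (ρ - 1) * q ^ e = ρ * (C / (ρ - 1) * q ^ e) := by
          have : ρ - 1 ≠ 0 := by linarith
          field_simp; ring
        have h5 : ρ * ((ρ⁻¹) ^ (k + 1) * G) = (ρ⁻¹) ^ k * G := by
          rw [pow_succ]; field_simp
        refine le_of_mul_le_mul_left ?_ (zero_lt_one.trans hρ1)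
        rw [mul_add, h5]
        linarith [h e]
    have t1 : ∀ e, |g e| ≤ C / (ρ - 1) * q ^ e := by
      intro e
      have := ((tendsto_pow_atTop_nhds_zero_of_lt_one (inv_nonneg.2 hρ)
        (inv_lt_one_of_one_lt₀ hρ1)).mul_const G).add_const (C / (ρ - 1) * q ^ e)
      rw [zero_mul, zero_add] at this
      exact ge_of_tendsto' this fun k => key k e
    refine ⟨0, squeeze_zero_norm t1 ?_⟩
    simpa using (tendsto_pow_atTop_nhds_zero_of_lt_one hq.le hq1).const_mul (C / (ρ - 1))

/-- A maximal independent subfamily of the generators spans a free submodule. Some nonzero multiple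
of each generator falls into it, and c is the product of these multipliers. The map `ψ` is
multiplication by c into that submodule. -/
lemma exists_free_comparison (D M : Type*) [CommRing D] [IsDomain D] [AddCommGroup M] [Module D M]
    [Module.Finite D M] : ∃ (r : ℕ) (φ : (Fin r → D) →ₗ[D] M) (ψ : M →ₗ[D] (Fin r → D)),
    ∃ c : D, c ≠ 0 ∧ (∀ m, c • m ∈ LinearMap.range φ) ∧
      ∀ v : Fin r → D, c • v ∈ LinearMap.range ψ := by
  classical
  obtain ⟨n, v, hv⟩ := Submodule.fg_iff_exists_fin_generating_family.1
    (Module.Finite.fg_top (R := D) (M := M))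
  obtain ⟨s, hs, hmax⟩ := exists_maximal_linearIndepOn D v
  have hcoef : ∀ i, ∃ a : D, a ≠ 0 ∧ a • v i ∈ Submodule.span D (v '' s) := by
    intro i
    by_cases hi : i ∈ s
    · exact ⟨1, one_ne_zero, by rw [one_smul]; exact Submodule.subset_span ⟨i, hi, rfl⟩⟩
    · exact hmax i hi
  choose a ha ha' using hcoef
  let e := Finite.equivFin s
  let w : Fin (Nat.card s) → M := fun i => v (e.symm i)
  have hw : LinearIndependent D w := hs.comp _ e.symm.injective
  have hrange : Set.range w = v '' s := by
    ext m
    constructor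
    · rintro ⟨i, rfl⟩; exact ⟨_, (e.symm i).2, rfl⟩
    · rintro ⟨i, hi, rfl⟩; exact ⟨e ⟨i, hi⟩, congrArg (fun j : s => v j) (e.symm_apply_apply ⟨i, hi⟩)⟩
  let φ : (Fin (Nat.card s) → D) →ₗ[D] M := Fintype.linearCombination D w
  have hφ : LinearMap.range φ = Submodule.span D (v '' s) := by
    rw [← hrange]; exact Fintype.range_linearCombination D w
  have hinj : Function.Injective φ := hw.fintypeLinearCombination_injective
  let c := ∏ i, a i
  have hc : ∀ m, c • m ∈ LinearMap.range φ := by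
    intro m
    have hm : m ∈ Submodule.span D (Set.range v) := hv ▸ Submodule.mem_top
    rw [hφ]
    induction hm using Submodule.span_induction with
    | mem m h =>
      obtain ⟨i, rfl⟩ := h
      simp only [c]
      rw [← Finset.prod_erase_mul _ _ (Finset.mem_univ i), mul_smul]
      exact Submodule.smul_mem _ _ (ha' i)
    | zero => simp
    | add x y _ _ hx hy => rw [smul_add]; exact add_mem hx hy
    | smul b x _ hx => rw [smul_comm]; exact Submodule.smul_mem _ _ hx
  let ψ : M →ₗ[D] (Fin (Nat.card s) → D) :=
    (LinearEquiv.ofInjective φ hinj).symm.toLinearMap ∘ₗ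
      (LinearMap.lsmul D M c).codRestrict _ hc
  refine ⟨_, φ, ψ, c, Finset.prod_ne_zero_iff.2 fun i _ => ha i, hc, fun v => ⟨φ v, ?_⟩⟩
  rw [LinearMap.comp_apply, LinearEquiv.coe_coe, LinearEquiv.symm_apply_eq]
  exact Subtype.ext (map_smul φ c v).symm

lemma le_of_add_one_le_natCast {x : WithBot ℕ∞} {n : ℕ} (h : x + 1 ≤ (n + 1 : ℕ)) : x ≤ n := by
  induction x with
  | bot => exact bot_le
  | coe x =>
    have h' : x + 1 ≤ (n : ℕ∞) + 1 := by exact_mod_cast h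
    exact_mod_cast (ENat.add_le_add_iff_right ENat.one_ne_top).1 h'

lemma isParam_span_singleton {D : Type*} [CommRing D] [IsDomain D] [IsLocalRing D]
    [IsNoetherianRing D] {δ : ℕ} (h : ringKrullDim D ≤ (δ + 1 : ℕ)) {c : D} (hc : c ≠ 0) :
    IsParam (Ideal.span {c}) δ := by
  refine isParam_of_ringKrullDim_le ?_
  have h1 := (ringKrullDim_quotient_succ_le_of_nonZeroDivisor
    (mem_nonZeroDivisors_of_ne_zero hc)).trans h
  exact le_of_add_one_le_natCast h1

lemma exists_sLength_compare_of_isDomain {D : Type*} [CommRing D] [IsDomain D] [IsLocalRing D]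
    [IsNoetherianRing D] {δ : ℕ} (p : ℕ) (h : ringKrullDim D ≤ (δ + 1 : ℕ)) (M : Type*)
    [AddCommGroup M] [Module D M] [Module.Finite D M] :
    ∃ r : ℕ, AsympLe p δ (sLength D M p) (fun a e => r * sLength D D p a e) ∧
      AsympLe p δ (fun a e => r * sLength D D p a e) (sLength D M p) := by
  obtain ⟨r, φ, ψ, c, hc, hφ, hψ⟩ := exists_free_comparison D M
  have hpar := isParam_span_singleton h hc
  have e : (fun a e => r * sLength D D p a e) = sLength D (Fin r → D) p := by
    ext a e; rw [sLength_fin]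
  refine ⟨r, ?_⟩
  rw [e]
  exact ⟨ asympLe_of_range p hpar φ hφ, asympLe_of_range p hpar ψ hψ⟩

lemma exists_sLength_frobeniusTwist_compare {A : Type*} [CommRing A] [IsLocalRing A]
    [IsNoetherianRing A] {p δ : ℕ} [Fact p.Prime] [ExpChar A p]
    (hperf : ∀ b : A, ∃ a, b - a ^ p ∈ maximalIdeal A) (hA : IsParam (⊥ : Ideal A) (δ + 1))
    (j : ℕ) {s : ℝ} (hs : 0 < s) : ∃ C : ℕ, ∀ e,
    sLength A A p ⌈s * (p : ℝ) ^ (e + j)⌉₊ (e + j) ≤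
      sLength A (FrobeniusTwist A p j) p ⌈s * (p : ℝ) ^ e⌉₊ e ∧
    sLength A (FrobeniusTwist A p j) p ⌈s * (p : ℝ) ^ e⌉₊ e ≤
      sLength A A p ⌈s * (p : ℝ) ^ (e + j)⌉₊ (e + j) + ((C * p ^ (δ * e) : ℕ) : ℕ∞) := by
  obtain ⟨c, hc⟩ := exists_sLength_frobeniusTwist_le hperf j
  obtain ⟨C, hC⟩ := exists_sLength_add_le (M := A) p hA
  -- The exponent is off by at most p^j from the ceilings and by c from comparing powers; p^(δj)
  -- appears because the error is taken at level e + j.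
  refine ⟨(p ^ j + c) * (C * p ^ (δ * j)), fun e => ⟨?_, ?_⟩⟩
  · refine le_trans ?_ (sLength_le_sLength_frobeniusTwist hperf j _ e)
    refine quotLength_anti (sup_le_sup_right (Ideal.pow_le_pow_right ?_) _)
    rw [Nat.ceil_le]
    push_cast
    rw [pow_add, mul_comm ((p : ℝ) ^ e), ← mul_assoc, mul_comm s, mul_assoc]
    gcongr
    exact Nat.le_ceil _
  · refine (hc _ e).trans ?_
    have h1 : p ^ j * ⌈s * (p : ℝ) ^ e⌉₊ + c ≤ ⌈s * (p : ℝ) ^ (e + j)⌉₊ + (p ^ j + c) := by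
      rw [← add_assoc]
      gcongr
      have h2 := Nat.ceil_lt_add_one (a := s * (p : ℝ) ^ e) (by positivity)
      have h3 := Nat.le_ceil (s * (p : ℝ) ^ (e + j))
      have h4 : (p : ℝ) ^ j * ⌈s * (p : ℝ) ^ e⌉₊ ≤ p ^ j * (s * (p : ℝ) ^ e + 1) := by gcongr
      have h5 : (p : ℝ) ^ j * (s * (p : ℝ) ^ e + 1) = s * (p : ℝ) ^ (e + j) + p ^ j := by
        rw [pow_add]; ring
      have h6 : ((p ^ j * ⌈s * (p : ℝ) ^ e⌉₊ : ℕ) : ℝ) ≤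
          ((⌈s * (p : ℝ) ^ (e + j)⌉₊ + p ^ j : ℕ) : ℝ) := by
        push_cast; linarith
      exact_mod_cast h6
    refine (quotLength_anti (sup_le_sup_right (Ideal.pow_le_pow_right h1) _)).trans ?_
    refine (hC _ _ _).trans_eq ?_
    rw [mul_add δ, pow_add]
    congr 2
    ring

/-- The normalized sequence of lengths whose limit is the `h`-function. -/
noncomputable def normLength (A M : Type*) [CommRing A] [IsLocalRing A] [AddCommGroup M]
    [Module A M] (p d : ℕ) (s : ℝ) (e : ℕ) : ℝ :=
  ((sLength A M p ⌈s * (p : ℝ) ^ e⌉₊ e).toNat : ℝ) / (p : ℝ) ^ (d * e)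

lemma toNat_le_add {x y : ℕ∞} {r c : ℕ} (hy : y ≠ ⊤) (h : x ≤ r * y + (c : ℕ∞)) :
    (x.toNat : ℝ) ≤ r * y.toNat + c := by
  obtain ⟨y, rfl⟩ := ENat.ne_top_iff_exists.1 hy
  have hx : x ≠ ⊤ := ne_top_of_le_ne_top (by exact_mod_cast ENat.natCast_ne_top (r * y + c)) h
  obtain ⟨x, rfl⟩ := ENat.ne_top_iff_exists.1 hx
  simp only [ENat.toNat_natCast]
  exact_mod_cast h

lemma exists_tendsto_normLength_of_isDomain {D : Type*} [CommRing D] [IsDomain D] [IsLocalRing D]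
    [IsNoetherianRing D] {p δ : ℕ} [Fact p.Prime] [ExpChar D p]
    (hperf : ∀ b : D, ∃ a, b - a ^ p ∈ maximalIdeal D)
    (hdim : ringKrullDim D ≤ (δ + 1 : ℕ)) [Module.Finite D (FrobeniusTwist D p 1)]
    {s : ℝ} (hs : 0 < s) : ∃ L, Tendsto (normLength D D p (δ + 1) s) atTop (𝓝 L) := by
  have hA : IsParam (⊥ : Ideal D) (δ + 1) := by
    refine isParam_of_ringKrullDim_le ?_
    rwa [ringKrullDim_eq_of_ringEquiv (RingEquiv.quotientBot D)]
  obtain ⟨C0, h0⟩ := exists_sLength_le (M := D) p ⊥ (by simp) hA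
  obtain ⟨C1, h1⟩ := exists_sLength_frobeniusTwist_compare hperf hA 1 hs
  obtain ⟨r, ⟨C2, h2⟩, C3, h3⟩ := exists_sLength_compare_of_isDomain p hdim (FrobeniusTwist D p 1)
  have hp : 1 < (p : ℝ) := by exact_mod_cast (Fact.out : p.Prime).one_lt
  have hp0 : 0 < (p : ℝ) := by linarith
  have hfin : ∀ a e, sLength D D p a e ≠ ⊤ := fun a e =>
    ne_top_of_le_ne_top (ENat.natCast_ne_top _) (h0 a e)
  -- Only dim D ≤ δ + 1 is assumed, so ρ need not be 1. Relative to p^((δ+1)e), an error of order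
  -- p^(δe) decays like p^(-e).
  refine exists_tendsto_of_approx_recursion (ρ := r / (p : ℝ) ^ (δ + 1)) (q := (p : ℝ)⁻¹)
    (G := C0) (C := (C1 + C2 + C3) / (p : ℝ) ^ (δ + 1)) (by positivity) (by positivity)
    (inv_lt_one_of_one_lt₀ hp) (fun e => ?_) (fun e => ?_)
  · rw [normLength, abs_of_nonneg (by positivity), div_le_iff₀ (by positivity)]
    have := toNat_le_add (x := sLength D D p ⌈s * (p : ℝ) ^ e⌉₊ e) (r := 0) (y := 0)
      (c := C0 * p ^ ((δ + 1) * e)) ENat.zero_ne_top (by rw [mul_zero, zero_add]; exact h0 _ e)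
    simpa using this
  · set u := sLength D D p ⌈s * (p : ℝ) ^ e⌉₊ e with hu
    set u' := sLength D D p ⌈s * (p : ℝ) ^ (e + 1)⌉₊ (e + 1) with hu'
    have hle : (u'.toNat : ℝ) ≤ r * u.toNat + C2 * (p : ℝ) ^ (δ * e) := by
      have := toNat_le_add (hfin _ _) ((h1 e).1.trans (h2 _ e))
      push_cast at this
      exact this
    have hge : r * (u.toNat : ℝ) ≤ u'.toNat + (C1 + C3) * (p : ℝ) ^ (δ * e) := by
      have h4 : (r * u : ℕ∞) ≤ (1 : ℕ) * u' + (((C1 + C3) * p ^ (δ * e) : ℕ) : ℕ∞) := by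
        refine (h3 _ e).trans ?_
        rw [Nat.cast_one, one_mul, add_mul, Nat.cast_add, ← add_assoc]
        gcongr
        exact (h1 e).2
      have := toNat_le_add (hfin _ _) h4
      rw [ENat.toNat_mul, ENat.toNat_natCast] at this
      push_cast at this
      rwa [one_mul] at this
    have e1 : normLength D D p (δ + 1) s (e + 1) -
        r / (p : ℝ) ^ (δ + 1) * normLength D D p (δ + 1) s e =
        (u'.toNat - r * u.toNat) / ((p : ℝ) ^ (δ + 1) * (p : ℝ) ^ ((δ + 1) * e)) := by
      rw [normLength, normLength, ← hu, ← hu', mul_add (δ + 1), pow_add _ ((δ + 1) * e), mul_one]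
      field_simp
    have e2 : (C1 + C2 + C3) / (p : ℝ) ^ (δ + 1) * ((p : ℝ)⁻¹) ^ e =
        ((C1 + C2 + C3) * (p : ℝ) ^ (δ * e)) / ((p : ℝ) ^ (δ + 1) * (p : ℝ) ^ ((δ + 1) * e)) := by
      rw [add_mul δ, one_mul, pow_add _ (δ * e), inv_pow]
      field_simp
    rw [e1, e2, abs_div, abs_of_pos (a := (p : ℝ) ^ (δ + 1) * _) (by positivity)]
    gcongr
    have hn : 0 ≤ (p : ℝ) ^ (δ * e) := by positivity
    have m1 : 0 ≤ (C1 : ℝ) * (p : ℝ) ^ (δ * e) := by positivity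
    have m2 : 0 ≤ (C2 : ℝ) * (p : ℝ) ^ (δ * e) := by positivity
    have m3 : 0 ≤ (C3 : ℝ) * (p : ℝ) ^ (δ * e) := by positivity
    rw [abs_le]
    constructor <;> nlinarith

/-! ### From domains to arbitrary rings through the minimal primes. -/

open scoped Pointwise in
lemma isParam_span_singleton_of_notMem_minimalPrimes {A : Type*} [CommRing A] [IsLocalRing A]
    [IsNoetherianRing A] {δ : ℕ} (h : ringKrullDim A ≤ (δ + 1 : ℕ)) {c : A}
    (hc : ∀ P ∈ minimalPrimes A, c ∉ P) : IsParam (Ideal.span {c}) δ := by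
  refine isParam_of_ringKrullDim_le (le_of_add_one_le_natCast (le_trans ?_ h))
  have h1 := Module.supportDim_quotSMulTop_succ_le_of_notMem_minimalPrimes (R := A) (M := A)
    (x := c) (by
      have : Module.annihilator A A = ⊥ := by
        rw [eq_bot_iff]; intro a ha; simpa using Module.mem_annihilator.1 ha 1
      rw [this]; exact hc)
  rw [Module.supportDim_self_eq_ringKrullDim] at h1
  refine le_trans (le_of_eq ?_) h1
  have h2 : Ideal.span {c} = c • (⊤ : Ideal A) := by
    simp [← Submodule.ideal_span_singleton_smul]
  rw [h2]
  congr 1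
  exact (Module.supportDim_quotient_eq_ringKrullDim (c • (⊤ : Ideal A))).symm

lemma exists_sLength_compare_of_isPrime {A : Type*} [CommRing A] [IsLocalRing A]
    [IsNoetherianRing A] {p δ : ℕ} [ExpChar A p] (h : ringKrullDim A ≤ (δ + 1 : ℕ)) (P : Ideal A)
    [P.IsPrime] [IsLocalRing (A ⧸ P)] [ExpChar (A ⧸ P) p] (M : Type*) [AddCommGroup M] [Module A M]
    [Module.Finite A M] (hM : ∀ c ∈ P, ∀ m : M, c • m = 0) :
    ∃ r : ℕ, AsympLe p δ (sLength A M p) (fun a e => r * sLength (A ⧸ P) (A ⧸ P) p a e) ∧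
      AsympLe p δ (fun a e => r * sLength (A ⧸ P) (A ⧸ P) p a e) (sLength A M p) := by
  have ht : Module.IsTorsionBySet A M (P : Set A) := fun m c => hM c c.2 m
  let := ht.module
  have : IsScalarTower A (A ⧸ P) M := ht.isScalarTower
  have : Module.Finite (A ⧸ P) M := Module.Finite.of_restrictScalars_finite A _ _
  have e : sLength A M p = sLength (A ⧸ P) M p := by
    ext a e
    exact sLength_of_surjective Ideal.Quotient.mk_surjective a e
  rw [e]
  exact exists_sLength_compare_of_isDomain p ((ringKrullDim_quotient_le P).trans h) M

lemma finite_frobeniusTwist_quotient {A : Type*} [CommRing A] {p j : ℕ} [ExpChar A p]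
    (P : Ideal A) [ExpChar (A ⧸ P) p] [Module.Finite A (FrobeniusTwist A p j)] :
    Module.Finite (A ⧸ P) (FrobeniusTwist (A ⧸ P) p j) := by
  let σ := Ideal.Quotient.mk P
  have : RingHomSurjective σ := ⟨Ideal.Quotient.mk_surjective⟩
  let f : FrobeniusTwist A p j →ₛₗ[σ] FrobeniusTwist (A ⧸ P) p j :=
    { toFun := fun x => (FrobeniusTwist.toBase (A ⧸ P) p j).symm
        (σ (FrobeniusTwist.toBase A p j x))
      map_add' := fun x y => by simp
      map_smul' := fun a x => by
        apply (FrobeniusTwist.toBase (A ⧸ P) p j).injective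
        simp [FrobeniusTwist.toBase_smul] }
  refine Module.Finite.of_surjective f fun y => ?_
  obtain ⟨x, hx⟩ := Ideal.Quotient.mk_surjective (FrobeniusTwist.toBase (A ⧸ P) p j y)
  refine ⟨(FrobeniusTwist.toBase A p j).symm x, ?_⟩
  apply (FrobeniusTwist.toBase (A ⧸ P) p j).injective
  exact hx

/-- Otherwise the intersection of the other minimal primes would lie in P, hence one of them would,
contradicting minimality. -/
lemma exists_notMem_mem_minimalPrimes {A : Type*} [CommRing A] [IsNoetherianRing A]
    (P : minimalPrimes A) : ∃ c : A, c ∉ P.1 ∧ ∀ Q : minimalPrimes A, Q ≠ P → c ∈ Q.1 := by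
  classical
  have : Fintype (minimalPrimes A) := (minimalPrimes.finite_of_isNoetherianRing A).fintype
  have hP : P.1.IsPrime := P.2.1.1
  by_contra! hcon
  have h1 : (Finset.univ.erase P).inf (fun Q : minimalPrimes A => Q.1) ≤ P.1 := by
    intro c hc
    by_contra hcP
    obtain ⟨Q, hQ, hcQ⟩ := hcon c hcP
    exact hcQ (Submodule.mem_finsetInf.1 hc Q (by simp [hQ]))
  obtain ⟨Q, hQ, hQP⟩ := hP.inf_le'.1 h1
  have h2 : P.1 ≤ Q.1 := P.2.2 ⟨Q.2.1.1, bot_le⟩ hQP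
  exact Finset.ne_of_mem_erase hQ (Subtype.ext (le_antisymm hQP h2))

lemma exists_pow_eq_zero_of_mem_minimalPrimes (A : Type*) [CommRing A] [IsNoetherianRing A]
    {p : ℕ} (hp : 1 < p) :
    ∃ j : ℕ, ∀ x : A, (∀ P ∈ minimalPrimes A, x ∈ P) → x ^ p ^ j = 0 := by
  obtain ⟨n, hn⟩ := IsNoetherianRing.isNilpotent_nilradical A
  refine ⟨n, fun x hx => ?_⟩
  have h1 : x ∈ nilradical A := by
    rw [nilradical, ← Ideal.sInf_minimalPrimes]
    exact Submodule.mem_sInf.2 hx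
  have h2 : x ^ n = 0 := by
    have := Ideal.pow_mem_pow h1 n
    rw [hn] at this
    exact this
  exact pow_eq_zero_of_le (Nat.lt_pow_self hp).le h2

lemma tendsto_toNat_div_of_le {p δ : ℕ} (hp : 1 < p) {u v : ℕ → ℕ∞} {C C' : ℕ}
    (huv : ∀ e, u e ≤ v e + ((C * p ^ (δ * e) : ℕ) : ℕ∞))
    (hvu : ∀ e, v e ≤ u e + ((C' * p ^ (δ * e) : ℕ) : ℕ∞)) (hv : ∀ e, v e ≠ ⊤) {L : ℝ}
    (hL : Tendsto (fun e => ((v e).toNat : ℝ) / (p : ℝ) ^ ((δ + 1) * e)) atTop (𝓝 L)) :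
    Tendsto (fun e => ((u e).toNat : ℝ) / (p : ℝ) ^ ((δ + 1) * e)) atTop (𝓝 L) := by
  have hp1 : 1 < (p : ℝ) := by exact_mod_cast hp
  have hp0 : 0 < (p : ℝ) := by linarith
  have hu : ∀ e, u e ≠ ⊤ := fun e => by
    obtain ⟨y, hy⟩ := ENat.ne_top_iff_exists.1 (hv e)
    refine ne_top_of_le_ne_top ?_ (huv e)
    rw [← hy, ← Nat.cast_add]
    exact ENat.natCast_ne_top _
  have h0 : Tendsto (fun e : ℕ => ((C : ℝ) + C') * ((p : ℝ)⁻¹) ^ e) atTop (𝓝 0) := by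
    simpa using (tendsto_pow_atTop_nhds_zero_of_lt_one (inv_nonneg.2 hp0.le)
      (inv_lt_one_of_one_lt₀ hp1)).const_mul ((C : ℝ) + C')
  have h1 : Tendsto (fun e => ((u e).toNat : ℝ) / (p : ℝ) ^ ((δ + 1) * e) -
      ((v e).toNat : ℝ) / (p : ℝ) ^ ((δ + 1) * e)) atTop (𝓝 0) := by
    refine squeeze_zero_norm (fun e => ?_) h0
    have a1 := toNat_le_add (x := u e) (r := 1) (c := C * p ^ (δ * e)) (hv e)
      (by rw [Nat.cast_one, one_mul]; exact huv e)
    have a2 := toNat_le_add (x := v e) (r := 1) (c := C' * p ^ (δ * e)) (hu e)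
      (by rw [Nat.cast_one, one_mul]; exact hvu e)
    push_cast at a1 a2
    have e2 : ((C : ℝ) + C') * ((p : ℝ)⁻¹) ^ e =
        ((C + C') * (p : ℝ) ^ (δ * e)) / (p : ℝ) ^ ((δ + 1) * e) := by
      rw [add_mul δ, one_mul, pow_add, inv_pow]
      field_simp
    rw [e2, ← sub_div, Real.norm_eq_abs, abs_div, abs_of_pos (a := (p : ℝ) ^ _) (by positivity)]
    gcongr
    have m1 : 0 ≤ (C : ℝ) * (p : ℝ) ^ (δ * e) := by positivity
    have m2 : 0 ≤ (C' : ℝ) * (p : ℝ) ^ (δ * e) := by positivity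
    rw [abs_le]
    constructor <;> nlinarith
  simpa using h1.add hL

/-- For j large the pushforward B is killed by the nilradical. With c_P outside P but inside every
other minimal prime, c_P B is a module over A/P, and c_P c_Q kills B for P ≠ Q. The element t = ∑
c_P avoids all minimal primes. Both composites of the evident maps between B and ∏ c_P B are
multiplication by t, so the two modules have asymptotically equal lengths. -/
theorem exists_tendsto_normLength {A : Type*} [CommRing A] [IsLocalRing A]
    [IsNoetherianRing A] {p δ : ℕ} [Fact p.Prime] [CharP A p]
    (hperf : ∀ b : A, ∃ a, b - a ^ p ∈ maximalIdeal A)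
    (hdim : ringKrullDim A ≤ (δ + 1 : ℕ)) (hfin : ∀ j, Module.Finite A (FrobeniusTwist A p j))
    {s : ℝ} (hs : 0 < s) : ∃ L, Tendsto (normLength A A p (δ + 1) s) atTop (𝓝 L) := by
  classical
  have hpp : p.Prime := Fact.out
  have : ExpChar A p := expChar_prime A p
  have hA : IsParam (⊥ : Ideal A) (δ + 1) := by
    refine isParam_of_ringKrullDim_le ?_
    rwa [ringKrullDim_eq_of_ringEquiv (RingEquiv.quotientBot A)]
  have : Fintype (minimalPrimes A) := (minimalPrimes.finite_of_isNoetherianRing A).fintype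
  obtain ⟨j, hj⟩ := exists_pow_eq_zero_of_mem_minimalPrimes A hpp.one_lt
  choose c hcP hcQ using exists_notMem_mem_minimalPrimes (A := A)
  have hprime : ∀ P : minimalPrimes A, P.1.IsPrime := fun P => P.2.1.1
  have hloc : ∀ P : minimalPrimes A, IsLocalRing (A ⧸ P.1) := fun P =>
    .of_surjective' (Ideal.Quotient.mk P.1) Ideal.Quotient.mk_surjective
  have hchar : ∀ P : minimalPrimes A, CharP (A ⧸ P.1) p := fun P =>
    (CharP.charP_iff_prime_eq_zero hpp).2 (by
      rw [← map_natCast (Ideal.Quotient.mk P.1), CharP.cast_eq_zero, map_zero])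
  have hexp : ∀ P : minimalPrimes A, ExpChar (A ⧸ P.1) p := fun P => expChar_prime _ p
  let B := FrobeniusTwist A p j
  have := hfin j
  have hsmul0 : ∀ x : A, (∀ P ∈ minimalPrimes A, x ∈ P) → ∀ b : B, x • b = 0 := by
    intro x hx b
    apply (FrobeniusTwist.toBase A p j).injective
    rw [FrobeniusTwist.toBase_smul, hj x hx, zero_mul, map_zero]
  have hcc : ∀ P Q : minimalPrimes A, P ≠ Q → ∀ b : B, (c P * c Q) • b = 0 := by
    intro P Q hPQ
    refine hsmul0 _ fun T hT => ?_
    by_cases hTP : (⟨T, hT⟩ : minimalPrimes A) = P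
    · refine Ideal.mul_mem_left _ _ (hcQ Q ⟨T, hT⟩ ?_)
      rw [hTP]; exact hPQ
    · exact Ideal.mul_mem_right _ _ (hcQ P ⟨T, hT⟩ hTP)
  let M : minimalPrimes A → Submodule A B := fun P => LinearMap.range (LinearMap.lsmul A B (c P))
  let Φ : B →ₗ[A] (Π P, M P) := LinearMap.pi fun P => (LinearMap.lsmul A B (c P)).rangeRestrict
  let Ψ : (Π P, M P) →ₗ[A] B := ∑ P, (M P).subtype ∘ₗ LinearMap.proj P
  let t := ∑ P, c P
  have ht : ∀ P ∈ minimalPrimes A, t ∉ P := by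
    intro P hP htP
    refine hcP ⟨P, hP⟩ ?_
    have h1 : t = c ⟨P, hP⟩ + ∑ Q ∈ Finset.univ.erase ⟨P, hP⟩, c Q :=
      (Finset.add_sum_erase _ _ (Finset.mem_univ _)).symm
    have h2 : ∑ Q ∈ Finset.univ.erase (⟨P, hP⟩ : minimalPrimes A), c Q ∈ P :=
      sum_mem fun Q hQ => hcQ Q ⟨P, hP⟩ (Finset.ne_of_mem_erase hQ).symm
    rw [h1] at htP
    exact (Ideal.add_mem_iff_left _ h2).1 htP
  have htpar := isParam_span_singleton_of_notMem_minimalPrimes hdim ht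
  have hΨ : ∀ b : B, t • b ∈ LinearMap.range Ψ := by
    intro b
    refine ⟨Φ b, ?_⟩
    simp only [Ψ, Φ, t, LinearMap.sum_apply, Finset.sum_smul]
    rfl
  have hΦ : ∀ v : (Π P, M P), t • v ∈ LinearMap.range Φ := by
    intro v
    refine ⟨Ψ v, ?_⟩
    ext P
    choose w hw using fun Q => (v Q).2
    have h1 : Ψ v = ∑ Q, c Q • w Q := by
      simp only [Ψ, LinearMap.sum_apply]
      exact Finset.sum_congr rfl fun Q _ => (hw Q).symm
    have h2 : ((Φ (Ψ v) P : M P) : B) = c P • Ψ v := rfl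
    have h3 : (((t • v) P : M P) : B) = t • (c P • w P) := by
      exact (congrArg (t • ·) (hw P)).symm
    -- On both sides only the term at P survives, since mixed products c_P c_Q act as zero.
    rw [h2, h3, h1, Finset.smul_sum, Finset.sum_smul, Finset.sum_eq_single P,
      Finset.sum_eq_single P]
    · intro Q _ hQ
      rw [smul_smul]; exact hcc Q P hQ _
    · simp
    · intro Q _ hQ
      rw [smul_smul]; exact hcc P Q hQ.symm _
    · simp
  have hkill : ∀ P : minimalPrimes A, ∀ x ∈ P.1, ∀ m : M P, x • m = 0 := by
    rintro P x hx ⟨_, b, rfl⟩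
    ext
    change x • (c P • b) = 0
    rw [smul_smul]
    refine hsmul0 _ (fun T hT => ?_) b
    by_cases hTP : (⟨T, hT⟩ : minimalPrimes A) = P
    · rw [← hTP] at hx; exact Ideal.mul_mem_right _ _ hx
    · exact Ideal.mul_mem_left _ _ (hcQ P ⟨T, hT⟩ hTP)
  choose r hr1 hr2 using fun P : minimalPrimes A =>
    exists_sLength_compare_of_isPrime (p := p) hdim P.1 (M P) (hkill P)
  have hpi : sLength A (Π P, M P) p = fun a e => ∑ P, sLength A (M P) p a e := by
    ext a e; exact sLength_pi _ a e
  obtain ⟨C1, h1⟩ : AsympLe p δ (sLength A B p)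
      (fun a e => ∑ P : minimalPrimes A, r P * sLength (A ⧸ P.1) (A ⧸ P.1) p a e) :=
    (asympLe_of_range p htpar Ψ hΨ).trans (hpi ▸ AsympLe.sum hr1)
  obtain ⟨C2, h2⟩ : AsympLe p δ
      (fun a e => ∑ P : minimalPrimes A, r P * sLength (A ⧸ P.1) (A ⧸ P.1) p a e)
      (sLength A B p) :=
    AsympLe.trans (v := sLength A (Π P, M P) p) (hpi ▸ AsympLe.sum hr2)
      (asympLe_of_range p htpar Φ hΦ)
  obtain ⟨C3, h3⟩ := exists_sLength_frobeniusTwist_compare hperf hA j hs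
  have hD : ∀ P : minimalPrimes A,
      ∃ L, Tendsto (normLength (A ⧸ P.1) (A ⧸ P.1) p (δ + 1) s) atTop (𝓝 L) := by
    intro P
    have := hfin 1
    have : Module.Finite (A ⧸ P.1) (FrobeniusTwist (A ⧸ P.1) p 1) :=
      finite_frobeniusTwist_quotient P.1
    refine exists_tendsto_normLength_of_isDomain (fun b => ?_)
      ((ringKrullDim_quotient_le P.1).trans hdim) hs
    obtain ⟨b, rfl⟩ := Ideal.Quotient.mk_surjective b
    obtain ⟨a, ha⟩ := hperf b
    refine ⟨Ideal.Quotient.mk P.1 a, ?_⟩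
    rw [← map_pow, ← map_sub,
      ← map_maximalIdeal_of_surjective (Ideal.Quotient.mk P.1) Ideal.Quotient.mk_surjective]
    exact Ideal.mem_map_of_mem _ ha
  choose L hL using hD
  have hne : ∀ (P : minimalPrimes A) a e, sLength (A ⧸ P.1) (A ⧸ P.1) p a e ≠ ⊤ := by
    intro P a e
    have hAP : IsParam (⊥ : Ideal (A ⧸ P.1)) (δ + 1) := by
      refine isParam_of_ringKrullDim_le ?_
      rw [ringKrullDim_eq_of_ringEquiv (RingEquiv.quotientBot _)]
      exact (ringKrullDim_quotient_le P.1).trans hdim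
    obtain ⟨C0, h0⟩ := exists_sLength_le (M := A ⧸ P.1) p ⊥ (by simp) hAP
    exact ne_top_of_le_ne_top (ENat.natCast_ne_top _) (h0 a e)
  have hS : Tendsto (fun e => ((∑ P : minimalPrimes A, (r P : ℕ∞) *
      sLength (A ⧸ P.1) (A ⧸ P.1) p ⌈s * (p : ℝ) ^ e⌉₊ e).toNat : ℝ) / (p : ℝ) ^ ((δ + 1) * e))
      atTop (𝓝 (∑ P, r P * L P)) := by
    refine (tendsto_finsetSum _ fun P _ => (hL P).const_mul (r P : ℝ)).congr fun e => ?_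
    rw [ENat.toNat_sum (s := Finset.univ) (f := fun P : minimalPrimes A => (r P : ℕ∞) *
      sLength (A ⧸ P.1) (A ⧸ P.1) p ⌈s * (p : ℝ) ^ e⌉₊ e)
      fun P _ => WithTop.mul_ne_top (ENat.natCast_ne_top _) (hne P _ _)]
    simp only [ENat.toNat_mul, ENat.toNat_natCast, normLength]
    push_cast
    rw [Finset.sum_div]
    exact Finset.sum_congr rfl fun P _ => by ring
  have hU := tendsto_toNat_div_of_le (C' := C2 + C3) hpp.one_lt
    (u := fun e => sLength A A p ⌈s * (p : ℝ) ^ (e + j)⌉₊ (e + j))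
    (fun e => (h3 e).1.trans (h1 _ e)) (fun e => by
      refine (h2 _ e).trans ?_
      rw [add_mul, add_comm (C2 * _), Nat.cast_add, ← add_assoc]
      gcongr
      exact (h3 e).2) (fun e => by
      exact ENat.sum_ne_top.2 fun P _ =>
        WithTop.mul_ne_top (ENat.natCast_ne_top _) (hne P _ _)) hS
  -- Level e of the j-th pushforward is level e + j of A, so the limit found is that of the shifted
  -- sequence, rescaled.
  refine ⟨(∑ P, r P * L P) / (p : ℝ) ^ ((δ + 1) * j), (tendsto_add_atTop_iff_nat j).1 ?_⟩
  refine (hU.div_const _).congr fun e => ?_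
  rw [normLength, mul_add (δ + 1), pow_add _ ((δ + 1) * e), div_div]

/-! ### Fields of characteristic p are formally smooth over the prime field. -/

/-- Let E be the fibre product of k and B over B/I; a lift of f is a subring of E projecting
bijectively to k. Since p-th powers kill I, the Frobenius image of E projects injectively, and Zorn
gives a maximal such subring G above it. G is a field. If a is not in its image, then X^p - a^p is
irreducible over G, so adjoining (a, b) keeps the projection injective, against maximality. -/
lemma exists_ringHom_lift_of_sq_eq_bot {k B : Type*} [Field k] [CommRing B] [Nontrivial B] (p : ℕ)
    [hp : Fact p.Prime] [CharP k p] [CharP B p] (I : Ideal B) (hI : I ^ 2 = ⊥) (f : k →+* B ⧸ I) :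
    ∃ g : k →+* B, (Ideal.Quotient.mk I).comp g = f := by
  classical
  have hIp : ∀ x ∈ I, x ^ p = 0 := fun x hx => by
    have h : x ^ 2 = 0 := by
      have := Ideal.pow_mem_pow hx 2
      rwa [hI] at this
    exact pow_eq_zero_of_le hp.out.two_le h
  have hbp : ∀ b b' : B, Ideal.Quotient.mk I b = Ideal.Quotient.mk I b' → b ^ p = b' ^ p := by
    intro b b' h
    rw [← sub_eq_zero, ← sub_pow_char, hIp _ (Ideal.Quotient.eq.1 h)]
  let E : Subring (k × B) :=
    RingHom.eqLocus ((Ideal.Quotient.mk I).comp (RingHom.snd k B)) (f.comp (RingHom.fst k B))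
  let S : Set (Subring (k × B)) := {G | E.map (frobenius (k × B) p) ≤ G ∧ G ≤ E ∧
    ∀ x ∈ G, x.1 = 0 → x.2 = 0}
  have hS0 : E.map (frobenius (k × B) p) ∈ S := by
    refine ⟨le_rfl, ?_, ?_⟩
    · rintro _ ⟨x, hx, rfl⟩
      exact E.pow_mem hx p
    · rintro _ ⟨x, hx, rfl⟩ h0
      have h1 : x.1 = 0 := pow_eq_zero_iff hp.out.ne_zero |>.1 h0
      have h2 : Ideal.Quotient.mk I x.2 = f x.1 := hx
      rw [h1, map_zero, Ideal.Quotient.eq_zero_iff_mem] at h2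
      exact hIp _ h2
  obtain ⟨G, -, hG⟩ := zorn_le_nonempty₀ S (by
    intro c hcS hc G hGc
    refine ⟨sSup c, ⟨(hcS hGc).1.trans (le_sSup hGc), sSup_le fun H hH => (hcS hH).2.1, ?_⟩,
      fun H hH => le_sSup hH⟩
    intro x hx h0
    obtain ⟨H, hH, hxH⟩ := (Subring.mem_sSup_of_directedOn ⟨G, hGc⟩ hc.directedOn).1 hx
    exact (hcS hH).2.2 x hxH h0) _ hS0
  obtain ⟨⟨hG1, hG2, hG3⟩, hGmax⟩ := hG
  have hfrob : ∀ x ∈ E, x ^ p ∈ G := fun x hx => hG1 ⟨x, hx, rfl⟩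
  have hlift : ∀ a : k, ∃ b, (a, b) ∈ E := fun a => Ideal.Quotient.mk_surjective (f a)
  have hinj : ∀ x ∈ G, ∀ y ∈ G, x.1 = y.1 → x = y := fun x hx y hy h =>
    Prod.ext h (sub_eq_zero.1 (hG3 _ (G.sub_mem hx hy) (sub_eq_zero.2 h)))
  have hfield : IsField G := by
    refine ⟨⟨0, 1, fun h => ?_⟩, mul_comm, ?_⟩
    · exact zero_ne_one (congrArg (fun x : G => x.1.1) h)
    · rintro ⟨x, hx⟩ hx0
      have hx1 : x.1 ≠ 0 := fun h => hx0 (Subtype.ext (hinj x hx 0 G.zero_mem h))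
      obtain ⟨b, hb⟩ := hlift x.1⁻¹
      -- The inverse of x is y^p x^(p-1), with y any element of E over the inverse of the first
      -- coordinate; y itself need not lie in G.
      have hy : (x.1⁻¹, b) ^ p * x ^ (p - 1) ∈ G := G.mul_mem (hfrob _ hb) (G.pow_mem hx _)
      refine ⟨⟨_, hy⟩, Subtype.ext (hinj _ (G.mul_mem hx hy) 1 G.one_mem ?_)⟩
      change x.1 * (x.1⁻¹ ^ p * x.1 ^ (p - 1)) = 1
      rw [mul_left_comm, ← pow_succ', Nat.sub_add_cancel hp.out.one_le, ← mul_pow,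
        inv_mul_cancel₀ hx1, one_pow]
  let _ : Field G := hfield.toField
  let π : G →+* k := (RingHom.fst k B).comp G.subtype
  let π' : G →+* B := (RingHom.snd k B).comp G.subtype
  have hsurj : Function.Surjective π := by
    intro a
    by_contra! ha
    obtain ⟨b, hb⟩ := hlift a
    let c : G := ⟨(a, b) ^ p, hfrob _ hb⟩
    let _ : Algebra G k := π.toAlgebra
    have hirr : Irreducible (Polynomial.X ^ p - Polynomial.C c) := by
      refine X_pow_sub_C_irreducible_of_prime hp.out fun y hy => ha y ?_
      apply frobenius_inj k p
      exact (map_pow π y p).symm.trans (congrArg π hy)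
    have hmin : Polynomial.X ^ p - Polynomial.C c = minpoly G a := by
      refine minpoly.eq_of_irreducible_of_monic hirr ?_
        (Polynomial.monic_X_pow_sub_C c hp.out.ne_zero)
      rw [map_sub, map_pow, Polynomial.aeval_X, Polynomial.aeval_C]
      exact sub_self _
    let ev := Polynomial.eval₂RingHom G.subtype (a, b)
    have hle : G ≤ ev.range := fun x hx => ⟨Polynomial.C ⟨x, hx⟩, by simp [ev]⟩
    have hmem : ev.range ∈ S := by
      refine ⟨hG1.trans hle, ?_, ?_⟩
      · rintro _ ⟨P, rfl⟩
        change P.eval₂ G.subtype (a, b) ∈ E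
        rw [Polynomial.eval₂_eq_sum_range]
        exact E.sum_mem fun i _ => E.mul_mem (hG2 (P.coeff i).2) (E.pow_mem hb i)
      · rintro _ ⟨P, rfl⟩ h0
        have h1 : Polynomial.aeval a P = 0 := by
          rw [← h0]
          exact (Polynomial.hom_eval₂ P G.subtype (RingHom.fst k B) (a, b)).symm
        have h2 := minpoly.dvd G a h1
        rw [← hmin] at h2
        obtain ⟨Q, rfl⟩ := h2
        rw [map_mul]
        have h3 : ev (Polynomial.X ^ p - Polynomial.C c) = 0 := by
          simp [ev, c]
        rw [h3, zero_mul]; rfl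
    have := hGmax hmem hle
    exact ha ⟨(a, b), this ⟨Polynomial.X, by simp [ev]⟩⟩ rfl
  let e := RingEquiv.ofBijective π ⟨π.injective, hsurj⟩
  refine ⟨π'.comp e.symm.toRingHom, RingHom.ext fun a => ?_⟩
  have h : Ideal.Quotient.mk I (e.symm a).1.2 = f (e.symm a).1.1 := hG2 (e.symm a).2
  have h' : (e.symm a).1.1 = a := e.apply_symm_apply a
  rw [h'] at h
  exact h

theorem formallySmooth_zmod_of_field (p : ℕ) [Fact p.Prime] (k : Type*) [Field k]
    [Algebra (ZMod p) k] : Algebra.FormallySmooth (ZMod p) k := by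
  refine Algebra.FormallySmooth.of_comp_surjective fun B _ _ I hI f => ?_
  have : CharP k p := charP_of_injective_algebraMap (algebraMap (ZMod p) k).injective p
  rcases subsingleton_or_nontrivial B with hB | hB
  · let g : k →ₐ[ZMod p] B :=
      { toFun := fun _ => 0
        map_one' := Subsingleton.elim _ _
        map_mul' := fun _ _ => Subsingleton.elim _ _
        map_zero' := rfl
        map_add' := fun _ _ => Subsingleton.elim _ _
        commutes' := fun _ => Subsingleton.elim _ _ }
    have : Subsingleton (B ⧸ I) := Ideal.Quotient.mk_surjective.subsingleton
    exact ⟨g, AlgHom.ext fun _ => Subsingleton.elim _ _⟩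
  · have : CharP B p := charP_of_injective_algebraMap (algebraMap (ZMod p) B).injective p
    obtain ⟨g, hg⟩ := exists_ringHom_lift_of_sq_eq_bot p I hI f.toRingHom
    refine ⟨⟨g, fun r => ?_⟩, AlgHom.ext fun x => RingHom.congr_fun hg x⟩
    exact RingHom.congr_fun (Subsingleton.elim (g.comp (algebraMap (ZMod p) k)) (algebraMap _ _)) r

/-! ### Completion and extension of the residue field. -/

open scoped TensorProduct

lemma quotLength_self {A : Type*} [CommRing A] (J : Ideal A) :
    quotLength A A J = Module.length A (A ⧸ J) := by
  have h : (J • (⊤ : Submodule A A)) = J := by rw [smul_eq_mul, Ideal.mul_top]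
  rw [quotLength]
  exact (Submodule.quotEquivOfEq _ _ h).length_eq

lemma length_quotient_eq_of_ringHom {A B : Type*} [CommRing A] [CommRing B] (f : A →+* B)
    {J : Ideal A} {J' : Ideal B} (hs : Function.Surjective ((Ideal.Quotient.mk J').comp f))
    (hJ : J'.comap f = J) : Module.length A (A ⧸ J) = Module.length B (B ⧸ J') := by
  let _ : Algebra A B := f.toAlgebra
  have hs' : Function.Surjective (algebraMap A (B ⧸ J')) := hs
  rw [Module.length_eq_of_surjective (S := B) (R := B ⧸ J') (M := B ⧸ J')
    Ideal.Quotient.mk_surjective,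
    ← Module.length_eq_of_surjective (S := A) (R := B ⧸ J') (M := B ⧸ J') hs']
  have hker : J = LinearMap.ker (Algebra.linearMap A (B ⧸ J')) := by
    ext x
    rw [LinearMap.mem_ker, ← hJ, Ideal.mem_comap, ← Ideal.Quotient.eq_zero_iff_mem]
    rfl
  rw [(Submodule.quotEquivOfEq _ _ hker).length_eq]
  exact (LinearMap.quotKerEquivOfSurjective (Algebra.linearMap A (B ⧸ J')) hs').length_eq

section Completion

variable {S : Type*} [CommRing S] {n J : Ideal S} {N : ℕ}

/-- Together with `comap_map_algebraMap_adicCompletion`, this identifies S/J with its counterpart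
over the completion. Finite generation of n replaces Noetherianity, which K ⊗ A need not have. -/
lemma surjective_mk_comp_algebraMap_adicCompletion (hn : n.FG) (hJ : n ^ N ≤ J) :
    Function.Surjective ((Ideal.Quotient.mk (J.map (algebraMap S (AdicCompletion n S)))).comp
      (algebraMap S (AdicCompletion n S))) := by
  intro y
  obtain ⟨y, rfl⟩ := Ideal.Quotient.mk_surjective y
  obtain ⟨z, hz⟩ := Ideal.Quotient.mk_surjective (AdicCompletion.evalₐ n N y)
  refine ⟨z, ?_⟩
  rw [RingHom.comp_apply, Ideal.Quotient.eq]
  have h1 : algebraMap S (AdicCompletion n S) z - y ∈ (AdicCompletion.eval n S N).ker := by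
    have h2 : AdicCompletion.evalₐ n N (algebraMap S (AdicCompletion n S) z - y) = 0 := by
      rw [map_sub, ← hz, sub_eq_zero]
      exact AdicCompletion.evalₐ_of n N z
    have h3 := AdicCompletion.factor_evalₐ_eq_eval n
      (algebraMap S (AdicCompletion n S) z - y) (n := N) (le_of_eq (Ideal.mul_top _).symm)
    rw [h2, map_zero] at h3
    exact h3.symm
  rw [← AdicCompletion.pow_smul_top_eq_ker_eval hn, Ideal.smul_top_eq_map] at h1
  exact Ideal.map_mono hJ h1

lemma comap_map_algebraMap_adicCompletion (hJ : n ^ N ≤ J) :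
    (J.map (algebraMap S (AdicCompletion n S))).comap (algebraMap S (AdicCompletion n S)) = J := by
  refine le_antisymm (fun x hx => ?_) Ideal.le_comap_map
  have h1 : AdicCompletion.evalₐ n N (algebraMap S (AdicCompletion n S) x) ∈
      (J.map (algebraMap S (AdicCompletion n S))).map (AdicCompletion.evalₐ n N) :=
    Ideal.mem_map_of_mem _ hx
  have h2 : ∀ z, AdicCompletion.evalₐ n N (algebraMap S (AdicCompletion n S) z) =
      Ideal.Quotient.mk _ z := fun z => AdicCompletion.evalₐ_of n N z
  have h3 : (J.map (algebraMap S (AdicCompletion n S))).map (AdicCompletion.evalₐ n N) ≤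
      J.map (Ideal.Quotient.mk (n ^ N)) := by
    rw [Ideal.map_le_iff_le_comap, Ideal.map_le_iff_le_comap]
    intro z hz
    have h5 := Ideal.mem_map_of_mem (Ideal.Quotient.mk (n ^ N)) hz
    rw [← h2] at h5
    exact h5
  have h4 := h3 h1
  rw [h2, ← Ideal.mem_comap, Ideal.comap_map_of_surjective _ Ideal.Quotient.mk_surjective,
    ← RingHom.ker_eq_comap_bot, Ideal.mk_ker, sup_eq_left.2 hJ] at h4
  exact h4

end Completion

section CoefficientField

lemma length_eq_of_residue {k A M : Type*} [Field k] [CommRing A] [IsLocalRing A] [Algebra k A]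
    (hres : ∀ a : A, ∃ c : k, a - algebraMap k A c ∈ maximalIdeal A) [AddCommGroup M] [Module A M]
    [Module k M] [IsScalarTower k A M] : Module.length k M = Module.length A M := by
  have hloc : IsLocalHom (algebraMap k A) := inferInstance
  rw [IsLocalRing.length_restrictScalars k A M]
  have hs : Function.Surjective (algebraMap (ResidueField k) (ResidueField A)) := by
    intro x
    obtain ⟨a, rfl⟩ := residue_surjective x
    obtain ⟨c, hc⟩ := hres a
    refine ⟨residue k c, ?_⟩
    change residue A (algebraMap k A c) = residue A a
    exact ((Ideal.Quotient.mk_eq_mk_iff_sub_mem _ _).2 hc).symm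
  have h1 := Module.length_eq_of_surjective (S := ResidueField k) (R := ResidueField A)
    (M := ResidueField A) hs
  have h2 : Module.length (ResidueField A) (ResidueField A) = 1 :=
    Module.length_eq_one_iff.2 inferInstance
  rw [h1, h2, mul_one]

variable {k A K : Type*} [Field k] [CommRing A] [Algebra k A] [Field K] [Algebra k K]

lemma length_tensorProduct (M : Type*) [AddCommGroup M] [Module k M] :
    Module.length K (K ⊗[k] M) = Module.length k M := by
  rw [Module.length_eq_rank, Module.length_eq_rank, Module.rank_baseChange, Cardinal.toENat_lift]

lemma length_quotient_map_includeRight (J : Ideal A) :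
    Module.length K ((K ⊗[k] A) ⧸ J.map (Algebra.TensorProduct.includeRight : A →ₐ[k] K ⊗[k] A)) =
      Module.length k (A ⧸ J) := by
  rw [← length_tensorProduct (K := K) (A ⧸ J)]
  let g : K ⊗[k] A →ₐ[K] K ⊗[k] (A ⧸ J) :=
    Algebra.TensorProduct.map (AlgHom.id K K) (Ideal.Quotient.mkₐ k J)
  have hg : Function.Surjective g :=
    Algebra.TensorProduct.map_surjective (AlgHom.id K K) (Ideal.Quotient.mkₐ k J)
      Function.surjective_id Ideal.Quotient.mk_surjective
  have hker : J.map (Algebra.TensorProduct.includeRight : A →ₐ[k] K ⊗[k] A) = RingHom.ker g := by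
    have := Algebra.TensorProduct.lTensor_ker (A := K) (Ideal.Quotient.mkₐ k J)
      (Ideal.Quotient.mkₐ_surjective k J)
    have hk : RingHom.ker (Ideal.Quotient.mkₐ k J) = J := Ideal.mk_ker
    rw [hk] at this
    rw [← this]
    rfl
  exact ((Ideal.quotientEquivAlgOfEq K hker).trans
    (Ideal.quotientKerAlgEquivOfSurjective hg)).toLinearEquiv.length_eq

variable [IsLocalRing A]

lemma exists_sub_mem_map_includeRight
    (hres : ∀ a : A, ∃ c : k, a - algebraMap k A c ∈ maximalIdeal A)
    (x : K ⊗[k] A) : ∃ c : K, x - algebraMap K _ c ∈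
    (maximalIdeal A).map (Algebra.TensorProduct.includeRight : A →ₐ[k] K ⊗[k] A) := by
  induction x with
  | zero => exact ⟨0, by simp⟩
  | add x y hx hy =>
    obtain ⟨c, hc⟩ := hx
    obtain ⟨d, hd⟩ := hy
    refine ⟨c + d, ?_⟩
    rw [map_add, add_sub_add_comm]
    exact Ideal.add_mem _ hc hd
  | tmul c a =>
    obtain ⟨l, hl⟩ := hres a
    refine ⟨l • c, ?_⟩
    have h : c ⊗ₜ[k] a - algebraMap K (K ⊗[k] A) (l • c) =
        c ⊗ₜ[k] 1 * Algebra.TensorProduct.includeRight (a - algebraMap k A l) := by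
      rw [Algebra.TensorProduct.includeRight_apply, Algebra.TensorProduct.tmul_mul_tmul, mul_one,
        one_mul, TensorProduct.tmul_sub, Algebra.algebraMap_eq_smul_one,
        Algebra.algebraMap_eq_smul_one, ← TensorProduct.smul_tmul,
        Algebra.TensorProduct.one_def, TensorProduct.smul_tmul', smul_eq_mul, mul_one]
    rw [h]
    exact Ideal.mul_mem_left _ _ (Ideal.mem_map_of_mem _ hl)

/-- The quotient has length one over K, so K maps isomorphically onto it. -/
lemma isMaximal_map_includeRight
    (hres : ∀ a : A, ∃ c : k, a - algebraMap k A c ∈ maximalIdeal A) :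
    ((maximalIdeal A).map (Algebra.TensorProduct.includeRight : A →ₐ[k] K ⊗[k] A)).IsMaximal := by
  set n := (maximalIdeal A).map (Algebra.TensorProduct.includeRight : A →ₐ[k] K ⊗[k] A)
  have hlen : Module.length K ((K ⊗[k] A) ⧸ n) = 1 := by
    rw [length_quotient_map_includeRight, length_eq_of_residue (A := A) hres]
    exact Module.length_eq_one_iff.2 (isSimpleModule_iff_isCoatom.2
      (Ideal.isMaximal_def.1 (maximalIdeal.isMaximal A)))
  have hnt : Nontrivial ((K ⊗[k] A) ⧸ n) := by
    rw [← Module.length_pos_iff (R := K), hlen]; exact one_pos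
  have hsurj : Function.Surjective (algebraMap K ((K ⊗[k] A) ⧸ n)) := by
    intro x
    obtain ⟨x, rfl⟩ := Ideal.Quotient.mk_surjective x
    obtain ⟨c, hc⟩ := exists_sub_mem_map_includeRight (K := K) hres x
    exact ⟨c, ((Ideal.Quotient.mk_eq_mk_iff_sub_mem _ _).2 hc).symm⟩
  let e := RingEquiv.ofBijective (algebraMap K ((K ⊗[k] A) ⧸ n)) ⟨RingHom.injective _, hsurj⟩
  exact Ideal.Quotient.maximal_of_isField _ (e.symm.toMulEquiv.isField (Field.toIsField K))

end CoefficientField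

universe u

/-- Extension of the residue field of a local ring with a coefficient field, followed by
completion. -/
theorem exists_residue_extension_of_coefficientField {k : Type u} {A : Type u} [Field k]
    [CommRing A] [IsLocalRing A] [Algebra k A]
    (hres : ∀ a : A, ∃ c : k, a - algebraMap k A c ∈ maximalIdeal A)
    (hfg : (maximalIdeal A).FG) (K : Type u) [Field K] [Algebra k K] :
    ∃ (B : Type u) (_ : CommRing B) (_ : IsLocalRing B) (_ : Algebra K B) (f : A →+* B),
      maximalIdeal B = (maximalIdeal A).map f ∧ IsAdicComplete (maximalIdeal B) B ∧
      (∀ b : B, ∃ c : K, b - algebraMap K B c ∈ maximalIdeal B) ∧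
      ∀ (J : Ideal A) (N : ℕ), maximalIdeal A ^ N ≤ J →
        quotLength A A J = quotLength B B (J.map f) := by
  let ι : A →ₐ[k] K ⊗[k] A := Algebra.TensorProduct.includeRight
  let n := (maximalIdeal A).map ι
  have hn : n.FG := hfg.map ι.toRingHom
  have hnm : n.IsMaximal := isMaximal_map_includeRight hres
  let B := AdicCompletion n (K ⊗[k] A)
  let g : K ⊗[k] A →+* B := algebraMap (K ⊗[k] A) B
  have hmax : (n.map g).IsMaximal := AdicCompletion.isMaximal_map_of_le n n le_rfl hn
  have hcomp : IsAdicComplete (n.map g) B := AdicCompletion.isAdicComplete_self n hn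
  have hloc : IsLocalRing B := isLocalRing_of_isAdicComplete_maximal (n.map g)
  have hB : maximalIdeal B = n.map g := (IsLocalRing.eq_maximalIdeal hmax).symm
  have hresB : ∀ b : B, ∃ c : K, b - algebraMap K B c ∈ maximalIdeal B := by
    intro b
    obtain ⟨x, hx⟩ := surjective_mk_comp_algebraMap_adicCompletion (N := 1) hn
      (pow_one n).le (Ideal.Quotient.mk _ b)
    obtain ⟨c, hc⟩ := exists_sub_mem_map_includeRight (K := K) hres x
    refine ⟨c, ?_⟩
    have h1 : b - g x ∈ maximalIdeal B := by
      rw [hB]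
      exact (Ideal.Quotient.mk_eq_mk_iff_sub_mem _ _).1 hx.symm
    have h2 : g (x - algebraMap K _ c) ∈ maximalIdeal B := by
      rw [hB]
      exact Ideal.mem_map_of_mem _ hc
    have h3 : algebraMap K B c = g (algebraMap K _ c) := IsScalarTower.algebraMap_apply K _ B c
    rw [map_sub, ← h3] at h2
    simpa using Ideal.add_mem _ h1 h2
  refine ⟨B, inferInstance, hloc, inferInstance, g.comp ι.toRingHom, ?_, hB ▸ hcomp, hresB, ?_⟩
  · rw [hB, ← Ideal.map_map]; rfl
  · intro J N hJ
    have hJn : n ^ N ≤ J.map ι := by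
      rw [← Ideal.map_pow]
      exact Ideal.map_mono hJ
    have hmap : J.map (g.comp ι.toRingHom) = (J.map ι).map g := (Ideal.map_map _ _).symm
    rw [quotLength_self, quotLength_self, hmap, ← length_eq_of_residue (k := k) hres,
      ← length_eq_of_residue (k := K) hresB, ← length_quotient_map_includeRight (K := K)]
    let φ := Ideal.quotientMapₐ ((J.map ι).map g) (IsScalarTower.toAlgHom K (K ⊗[k] A) B)
      (Ideal.le_comap_map (f := g) (I := J.map ι))
    refine (AlgEquiv.ofBijective φ ⟨?_, ?_⟩).toLinearEquiv.length_eq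
    · exact Ideal.quotientMap_injective' (H := Ideal.le_comap_map (f := g))
        (comap_map_algebraMap_adicCompletion hJn).le
    · intro y
      obtain ⟨x, hx⟩ := surjective_mk_comp_algebraMap_adicCompletion hn hJn y
      exact ⟨Ideal.Quotient.mk _ x, hx⟩

/-- A local ring of characteristic `p` has an extension which is complete, contains an algebraically
closed coefficient field, and has the same lengths. -/
theorem exists_residue_extension (R : Type u) [CommRing R] [IsLocalRing R] (p : ℕ)
    [Fact p.Prime] [CharP R p] (hfg : (maximalIdeal R).FG) :
    ∃ (K : Type u) (_ : Field K) (_ : IsAlgClosed K) (B : Type u) (_ : CommRing B)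
      (_ : IsLocalRing B) (_ : Algebra K B) (f : R →+* B), CharP B p ∧
      maximalIdeal B = (maximalIdeal R).map f ∧ IsAdicComplete (maximalIdeal B) B ∧
      (∀ b : B, ∃ c : K, b - algebraMap K B c ∈ maximalIdeal B) ∧
      ∀ (J : Ideal R) (N : ℕ), maximalIdeal R ^ N ≤ J →
        quotLength R R J = quotLength B B (J.map f) := by
  let _ : Algebra (ZMod p) R := ZMod.algebra R p
  let k := ResidueField R
  let A := AdicCompletion (maximalIdeal R) R
  have hA : IsLocalRing A := AdicCompletion.isLocalRing_of_fg hfg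
  have hmA := AdicCompletion.maximalIdeal_eq_map_of_fg hfg
  have hsm := formallySmooth_zmod_of_field p k
  -- Formal smoothness lifts the identity of the residue field to the completion; the lift is a
  -- coefficient field.
  obtain ⟨σ, hσ⟩ := Algebra.FormallySmooth.exists_adicCompletionEvalOneₐ_comp_eq (R := ZMod p)
    (A := k) (S := R) (I := maximalIdeal R) (AlgHom.id (ZMod p) k)
  let _ : Algebra k A := σ.toRingHom.toAlgebra
  have hres : ∀ a : A, ∃ c : k, a - algebraMap k A c ∈ maximalIdeal A := by
    intro a
    refine ⟨AdicCompletion.evalOneₐ _ a, ?_⟩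
    rw [hmA, ← AdicCompletion.ker_evalOneₐ_eq_map _ hfg, RingHom.mem_ker]
    rw [map_sub, sub_eq_zero]
    exact (AlgHom.congr_fun hσ (AdicCompletion.evalOneₐ _ a)).symm
  obtain ⟨B, _, _, _, f, hf1, hf2, hf3, hf4⟩ := exists_residue_extension_of_coefficientField hres
    (hmA ▸ hfg.map _) (AlgebraicClosure k)
  have : CharP (AlgebraicClosure k) p :=
    charP_of_injective_algebraMap (algebraMap (ZMod p) (AlgebraicClosure k)).injective p
  refine ⟨AlgebraicClosure k, inferInstance, inferInstance, B, inferInstance, inferInstance,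
    inferInstance, f.comp (algebraMap R A),
    charP_of_injective_algebraMap (algebraMap (AlgebraicClosure k) B).injective p, ?_, hf2, hf3, ?_⟩
  · rw [hf1, hmA, Ideal.map_map]
  · intro J N hJ
    rw [← Ideal.map_map, ← hf4 _ N, quotLength_self, quotLength_self]
    · exact length_quotient_eq_of_ringHom _ (surjective_mk_comp_algebraMap_adicCompletion hfg hJ)
        (comap_map_algebraMap_adicCompletion hJ)
    · rw [hmA, ← Ideal.map_pow]
      exact Ideal.map_mono hJ

/-! ### Noetherianity and finiteness of Frobenius for complete rings. -/

/-- B is a quotient of a power series ring over K: the variables go to generators of the maximal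
ideal, the map is built from truncations modulo each power, and surjectivity modulo the variables
lifts by completeness. -/
theorem isNoetherianRing_of_isAdicComplete {K B : Type*} [Field K] [CommRing B] [IsLocalRing B]
    [Algebra K B] [IsAdicComplete (maximalIdeal B) B] (hfg : (maximalIdeal B).FG)
    (hres : ∀ b : B, ∃ c : K, b - algebraMap K B c ∈ maximalIdeal B) : IsNoetherianRing B := by
  obtain ⟨n, x, hx⟩ := Submodule.fg_iff_exists_fin_generating_family.1 hfg
  let φ : MvPolynomial (Fin n) K →ₐ[K] B := MvPolynomial.aeval x
  let V := MvPolynomial.idealOfVars (Fin n) K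
  have hV : V.map φ = maximalIdeal B := by
    rw [← hx, Ideal.submodule_span_eq]
    simp only [V, MvPolynomial.idealOfVars, Ideal.map_span, ← Set.range_comp]
    congr 2
    ext i
    simp [φ]
  have hVn : ∀ m, V ^ m ≤ (maximalIdeal B ^ m).comap φ.toRingHom := by
    intro m
    rw [← Ideal.map_le_iff_le_comap, Ideal.map_pow]
    exact (Ideal.pow_right_mono hV.le m)
  let F : ∀ m, MvPowerSeries (Fin n) K →+* B ⧸ maximalIdeal B ^ m := fun m =>
    (Ideal.quotientMap _ φ.toRingHom (hVn m)).comp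
      (MvPowerSeries.truncTotalAlgHom (Fin n) K m).toRingHom
  have hF : ∀ {l m : ℕ} (hle : l ≤ m),
      (Ideal.Quotient.factorPow (maximalIdeal B) hle).comp (F m) = F l := by
    intro l m hle
    ext f
    have h1 := hVn l (MvPowerSeries.truncTotal_sub_truncTotal_mem_pow_idealOfVars hle le_rfl f)
    rw [Ideal.mem_comap, map_sub] at h1
    exact (Ideal.Quotient.mk_eq_mk_iff_sub_mem _ _).2 h1
  let Φ := IsAdicComplete.liftRingHom (maximalIdeal B) F hF
  have hΦ : ∀ P : MvPolynomial (Fin n) K, Φ (P : MvPowerSeries (Fin n) K) = φ P := by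
    intro P
    refine (IsHausdorff.eq_iff_smodEq (I := maximalIdeal B)).2 fun m => ?_
    rw [SModEq.sub_mem, smul_eq_mul, Ideal.mul_top, ← Ideal.Quotient.mk_eq_mk_iff_sub_mem]
    have h1 : Ideal.Quotient.mk (maximalIdeal B ^ m) (Φ P) = F m P :=
      IsAdicComplete.mk_liftRingHom _ _ _ _ _
    rw [h1]
    have h2 : MvPowerSeries.truncTotalAlgHom (Fin n) K m (P : MvPowerSeries (Fin n) K) =
      Ideal.Quotient.mk (V ^ m) P := (MvPowerSeries.truncTotalAlgHom (Fin n) K m).commutes P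
    change Ideal.quotientMap _ φ.toRingHom (hVn m) (MvPowerSeries.truncTotalAlgHom (Fin n) K m P) = _
    rw [h2]
    rfl
  let I : Ideal (MvPowerSeries (Fin n) K) := Ideal.span (Set.range MvPowerSeries.X)
  have hI : I.map Φ = maximalIdeal B := by
    rw [← hx, Ideal.submodule_span_eq]
    simp only [I, Ideal.map_span, ← Set.range_comp]
    congr 2
    ext i
    have := hΦ (MvPolynomial.X i)
    rw [MvPolynomial.coe_X] at this
    simpa [φ] using this
  have haus : IsHausdorff (I.map Φ) B := by rw [hI]; infer_instance
  have hsurj : Function.Surjective Φ := by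
    refine surjective_of_mk_map_comp_surjective (I := I) Φ fun y => ?_
    obtain ⟨b, rfl⟩ := Ideal.Quotient.mk_surjective y
    obtain ⟨c, hc⟩ := hres b
    refine ⟨(MvPolynomial.C c : MvPolynomial (Fin n) K), ?_⟩
    rw [RingHom.comp_apply, hΦ, Eq.comm, Ideal.Quotient.mk_eq_mk_iff_sub_mem, hI]
    simpa [φ] using hc
  exact isNoetherianRing_of_surjective _ _ Φ hsurj

lemma isPrecomplete_pi {A : Type*} [CommRing A] {I : Ideal A} [IsPrecomplete I A] {ι : Type*}
    [Fintype ι] [DecidableEq ι] : IsPrecomplete I (ι → A) := by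
  rw [← AdicCompletion.of_surjective_iff]
  intro y
  choose x hx using fun i => AdicCompletion.of_surjective I A
    (AdicCompletion.piEquivOfFintype I (fun _ : ι => A) y i)
  refine ⟨x, (AdicCompletion.piEquivOfFintype I (fun _ : ι => A)).injective ?_⟩
  ext1 i
  rw [← hx i, AdicCompletion.piEquivOfFintype_apply]
  change AdicCompletion.map I (LinearMap.proj i) (AdicCompletion.of I _ x) = _
  rw [AdicCompletion.map_of]
  rfl

/-- The complete form of Nakayama: T/𝔪T has finite length, and T is 𝔪-adically separated by Krull's
intersection theorem in the Noetherian local ring T. -/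
theorem finite_frobeniusTwist_of_isAdicComplete {A : Type*} [CommRing A] [IsLocalRing A]
    [IsNoetherianRing A] [IsAdicComplete (maximalIdeal A) A] {p : ℕ} [Fact p.Prime] [ExpChar A p]
    (hperf : ∀ b : A, ∃ a, b - a ^ p ∈ maximalIdeal A) (j : ℕ) :
    Module.Finite A (FrobeniusTwist A p j) := by
  let T := FrobeniusTwist A p j
  have hT : IsNoetherianRing T := inferInstanceAs (IsNoetherianRing A)
  have hH : IsHausdorff (maximalIdeal A) T := by
    rw [← IsHausdorff.map_algebraMap_iff (S := T)]
    refine IsHausdorff.of_isLocalRing (R := T) _ _ ?_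
    refine ne_top_of_le_ne_top (maximalIdeal.isMaximal T).ne_top ?_
    have hloc : IsLocalHom (algebraMap A T) := inferInstance
    exact ((local_hom_TFAE (algebraMap A T)).out 0 2 :).1 hloc
  have hfin : Module.Finite A (T ⧸ (maximalIdeal A • ⊤ : Submodule A T)) := by
    have h1 : quotLength A T (maximalIdeal A) ≠ ⊤ := by
      rw [FrobeniusTwist.quotLength_eq hperf]
      obtain ⟨t, ht⟩ : ∃ t, maximalIdeal A ^ t ≤
          (maximalIdeal A).map (iterateFrobenius A p j) := by
        refine Ideal.exists_pow_le_of_le_radical_of_fg (fun x hx => ⟨p ^ j, ?_⟩)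
          (maximalIdeal A).fg_of_isNoetherianRing
        exact Ideal.mem_map_of_mem (iterateFrobenius A p j) hx
      exact ne_top_of_le_ne_top (quotLength_pow_maximalIdeal_ne_top t) (quotLength_anti ht)
    have h2 := Module.length_ne_top_iff.1 h1
    have := (isFiniteLength_iff_isNoetherian_isArtinian.1 h2).1
    infer_instance
  obtain ⟨n, g, hg⟩ := Module.Finite.exists_fin' A (T ⧸ (maximalIdeal A • ⊤ : Submodule A T))
  obtain ⟨f, hf⟩ := Module.projective_lifting_property
    (maximalIdeal A • ⊤ : Submodule A T).mkQ g (Submodule.mkQ_surjective _)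
  have := isPrecomplete_pi (I := maximalIdeal A) (ι := Fin n)
  exact Module.Finite.of_surjective f
    (surjective_of_mkQ_comp_surjective (I := maximalIdeal A) (f := f) (hf ▸ hg))

/-! ### Existence of the limit for every Noetherian local ring. -/

theorem exists_tendsto_normLength_of_ringKrullDim_le {R : Type*} [CommRing R] [IsLocalRing R]
    [IsNoetherianRing R] {p δ : ℕ} [hp : Fact p.Prime] [CharP R p]
    (hdim : ringKrullDim R ≤ (δ + 1 : ℕ)) {s : ℝ} (hs : 0 < s) :
    ∃ L, Tendsto (normLength R R p (δ + 1) s) atTop (𝓝 L) := by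
  obtain ⟨K, _, _, B, _, _, _, f, _, hmax, hcomp, hres, hlen⟩ :=
    exists_residue_extension R p (maximalIdeal R).fg_of_isNoetherianRing
  have : IsNoetherianRing B := isNoetherianRing_of_isAdicComplete
    (hmax ▸ (maximalIdeal R).fg_of_isNoetherianRing.map f) hres
  have : ExpChar B p := expChar_prime B p
  have : ExpChar R p := expChar_prime R p
  have hperf : ∀ b : B, ∃ a, b - a ^ p ∈ maximalIdeal B := by
    intro b
    obtain ⟨c, hc⟩ := hres b
    obtain ⟨d, rfl⟩ := IsAlgClosed.exists_pow_nat_eq c hp.out.pos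
    exact ⟨algebraMap K B d, by rwa [map_pow] at hc⟩
  have hR : IsParam (⊥ : Ideal R) (δ + 1) := by
    refine isParam_of_ringKrullDim_le ?_
    rwa [ringKrullDim_eq_of_ringEquiv (RingEquiv.quotientBot R)]
  -- Images of parameters of R are parameters of B, which bounds dim B from above; equality is not
  -- needed.
  have hB : IsParam (⊥ : Ideal B) (δ + 1) := by
    obtain ⟨x, hx, t, ht⟩ := hR
    refine ⟨f ∘ x, fun i => ?_, t, ?_⟩
    · rw [hmax]; exact Ideal.mem_map_of_mem f (hx i)
    · rw [hmax, ← Ideal.map_pow, Set.range_comp, ← Ideal.map_span]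
      refine (Ideal.map_mono ht).trans ?_
      rw [Ideal.map_sup, Ideal.map_bot]
  obtain ⟨L, hL⟩ := exists_tendsto_normLength hperf hB.ringKrullDim_le
    (fun j => finite_frobeniusTwist_of_isAdicComplete hperf j) hs
  have hs' : ∀ a e, sLength R R p a e = sLength B B p a e := by
    intro a e
    have h1 : maximalIdeal R ^ a ≤ sIdeal R p a e := le_sup_left
    rw [sLength, hlen _ a h1, sLength, sIdeal, sIdeal, Ideal.map_sup, Ideal.map_pow, hmax,
      map_frobeniusPower]
  exact ⟨L, hL.congr fun e => by rw [normLength, normLength, hs']⟩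

/-! ### Comparison of `R ⋈ I` with R × R. -/

/-- An ideal `I` with `dim R / I < dim R` contains an element `x` with `dim R / x < dim R`. -/
lemma exists_mem_ringKrullDim_quotient_span_le {R : Type*} [CommRing R] [IsNoetherianRing R]
    {δ : ℕ} {I : Ideal R} (hI : ringKrullDim (R ⧸ I) ≤ δ) (hR : ringKrullDim R ≤ (δ + 1 : ℕ)) :
    ∃ x ∈ I, ringKrullDim (R ⧸ Ideal.span {x}) ≤ δ := by
  -- Prime avoidance: x is chosen in I outside every minimal prime that does not contain I.
  obtain ⟨x, hxI, hx⟩ : ∃ x ∈ I, ∀ P ∈ minimalPrimes R, x ∈ P → I ≤ P := by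
    by_contra! hcon
    have hfin : {P ∈ minimalPrimes R | ¬ I ≤ P}.Finite :=
      (minimalPrimes.finite_of_isNoetherianRing R).subset fun P hP => hP.1
    have hsub : (I : Set R) ⊆ ⋃ P ∈ {P ∈ minimalPrimes R | ¬ I ≤ P}, ((P : Ideal R) : Set R) := by
      intro x hx
      obtain ⟨P, hP, hxP, hIP⟩ := hcon x hx
      exact Set.mem_biUnion (show P ∈ {P ∈ minimalPrimes R | ¬ I ≤ P} from ⟨hP, hIP⟩) hxP
    obtain ⟨P, hP, hIP⟩ := (Ideal.subset_union_prime_finite hfin (f := fun P => P) ⊥ ⊥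
      (fun P hP _ _ => hP.1.1.1)).1 hsub
    exact hP.2 hIP
  refine ⟨x, hxI, ?_⟩
  by_contra! hlt
  have hle : ((δ + 1 : ℕ) : WithBot ℕ∞) ≤ ringKrullDim (R ⧸ Ideal.span {x}) := by
    push_cast
    exact ENat.WithBot.add_one_le_iff.2 hlt
  rw [ringKrullDim_quotient] at hle
  obtain ⟨l, hl⟩ := Order.le_krullDim_iff.1 hle
  have hlR : ∀ l' : LTSeries (PrimeSpectrum R), l'.length ≤ δ + 1 := fun l' => by
    exact_mod_cast (Order.LTSeries.length_le_krullDim l').trans hR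
  let l₁ : LTSeries (PrimeSpectrum R) := l.map (fun P => P.1) fun _ _ h => h
  -- A chain of length δ + 1 above x must start at a minimal prime of R, else it could be extended
  -- downwards. That prime contains x, hence I, so the whole chain lives in R/I, which is too small
  -- for it.
  obtain ⟨P, hP, hPQ⟩ := Ideal.exists_minimalPrimes_le (I := ⊥) (J := l₁.head.asIdeal) bot_le
  have hPp : P.IsPrime := hP.1.1
  have hIQ : I ≤ l₁.head.asIdeal := by
    by_cases h : P = l₁.head.asIdeal
    · rw [← h]
      refine hx P hP ?_
      rw [h]
      exact l.head.2 (Ideal.subset_span rfl)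
    · have hlt : (⟨P, hPp⟩ : PrimeSpectrum R) < l₁.head := 
        lt_of_le_of_ne hPQ fun h' => h (by rw [← h'])
      have h1 := hlR (l₁.cons _ hlt)
      have h2 : (l₁.cons _ hlt).length = l.length + 1 := RelSeries.cons_length _ _ _
      omega
  have hmem : ∀ i, (l i).1 ∈ PrimeSpectrum.zeroLocus (I : Set R) := fun i =>
    hIQ.trans (l.head_le i : l.head ≤ l i)
  let l₂ : LTSeries (PrimeSpectrum.zeroLocus (I : Set R)) :=
    { length := l.length, toFun := fun i => ⟨(l i).1, hmem i⟩, step := fun i => l.step i }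
  have h2 := (Order.LTSeries.length_le_krullDim l₂)
  rw [← ringKrullDim_quotient] at h2
  have h3 := h2.trans hI
  simp only [l₂, hl] at h3
  have : δ + 1 ≤ δ := by exact_mod_cast h3
  omega

/-- The codomain of a ring homomorphism as a module over the domain. -/
def RestrictAlong {A R : Type*} [CommRing A] [CommRing R] (_π : A →+* R) : Type _ := R

namespace RestrictAlong

variable {A R : Type*} [CommRing A] [CommRing R] (π : A →+* R)

instance : CommRing (RestrictAlong π) := inferInstanceAs (CommRing R)

instance [IsLocalRing R] : IsLocalRing (RestrictAlong π) := inferInstanceAs (IsLocalRing R)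

instance [IsNoetherianRing R] : IsNoetherianRing (RestrictAlong π) :=
  inferInstanceAs (IsNoetherianRing R)

instance (p : ℕ) [ExpChar R p] : ExpChar (RestrictAlong π) p := inferInstanceAs (ExpChar R p)

instance : Algebra A (RestrictAlong π) := RingHom.toAlgebra (S := RestrictAlong π) π

lemma sLength_eq [IsLocalRing A] [IsLocalRing R] {p : ℕ} [ExpChar A p] [ExpChar R p]
    (hπ : Function.Surjective π) : sLength A (RestrictAlong π) p = sLength R R p := by
  ext a e
  have h := sLength_of_surjective (p := p) (A := A) (B := RestrictAlong π)
    (M := RestrictAlong π) hπ a e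
  exact h

end RestrictAlong

section Amalgam

variable {R : Type*} [CommRing R] (I : Ideal R)

/-- The diagonal embedding `R → R ⋈ I`. -/
def amalgDiag : R →+* amalgDup I where
  toFun r := ⟨(r, r), show r - r ∈ I by simp⟩
  map_one' := rfl
  map_mul' _ _ := rfl
  map_zero' := rfl
  map_add' _ _ := rfl

/-- The two projections `R ⋈ I → R`. -/
def amalgProj : Bool → (amalgDup I →+* R)
  | true => (RingHom.fst R R).comp (amalgDup I).subtype
  | false => (RingHom.snd R R).comp (amalgDup I).subtype

lemma amalgProj_surjective (b : Bool) : Function.Surjective (amalgProj I b) := fun r =>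
  ⟨amalgDiag I r, by cases b <;> rfl⟩

instance [IsNoetherianRing R] : IsNoetherianRing (amalgDup I) := by
  let _ : Algebra R (amalgDup I) := (amalgDiag I).toAlgebra
  let f : amalgDup I →ₗ[R] R × R :=
    { toFun := fun a => a.1
      map_add' := fun _ _ => rfl
      map_smul' := fun _ _ => rfl }
  have : IsNoetherian R (amalgDup I) := isNoetherian_of_injective f Subtype.val_injective
  exact isNoetherian_of_tower R this

variable [IsLocalRing R] [IsLocalRing (amalgDup I)]

/-- An element (r, r') is a root of (X - r)(X - r') over the diagonal copy of R. If it lies in the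
maximal ideal, so do r and r', and its square lies in the extension of 𝔪. -/
lemma IsParam.map_amalgDiag [IsNoetherianRing R] (hI : I ≠ ⊤) {𝔠 : Ideal R} {δ : ℕ}
    (h : IsParam 𝔠 δ) : IsParam (𝔠.map (amalgDiag I)) δ := by
  obtain ⟨x, hx, t, ht⟩ := h
  have h1 : maximalIdeal (amalgDup I) ≤ ((maximalIdeal R).map (amalgDiag I)).radical := by
    intro a ha
    have hmem : ∀ b, amalgProj I b a ∈ maximalIdeal R := by
      have h0 : amalgProj I true a ∈ maximalIdeal R := by
        rw [← map_maximalIdeal_of_surjective _ (amalgProj_surjective I true)]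
        exact Ideal.mem_map_of_mem _ ha
      rintro (_ | _)
      · have h2 : amalgProj I false a - amalgProj I true a ∈ I := a.2
        simpa using Ideal.add_mem _ (le_maximalIdeal hI h2) h0
      · exact h0
    refine ⟨2, ?_⟩
    have h3 : a ^ 2 = (amalgDiag I (amalgProj I true a) + amalgDiag I (amalgProj I false a)) * a -
        amalgDiag I (amalgProj I true a) * amalgDiag I (amalgProj I false a) := by
      apply Subtype.ext
      refine Prod.ext ?_ ?_
      · change a.1.1 ^ 2 = (a.1.1 + a.1.2) * a.1.1 - a.1.1 * a.1.2
        ring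
      · change a.1.2 ^ 2 = (a.1.1 + a.1.2) * a.1.2 - a.1.1 * a.1.2
        ring
    rw [h3]
    have hd := fun b => Ideal.mem_map_of_mem (amalgDiag I) (hmem b)
    exact Ideal.sub_mem _ (Ideal.mul_mem_right _ _ (Ideal.add_mem _ (hd _) (hd _)))
      (Ideal.mul_mem_right _ _ (hd _))
  obtain ⟨k, hk⟩ := Ideal.exists_pow_le_of_le_radical_of_fg h1
    (maximalIdeal (amalgDup I)).fg_of_isNoetherianRing
  refine ⟨fun i => amalgDiag I (x i), fun i => ?_, k * t, ?_⟩
  · rw [mem_maximalIdeal, mem_nonunits_iff]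
    intro hu
    exact (mem_maximalIdeal _).1 (hx i) (hu.map (amalgProj I true))
  · rw [pow_mul]
    refine (Ideal.pow_right_mono hk t).trans ?_
    rw [← Ideal.map_pow]
    refine (Ideal.map_mono ht).trans ?_
    rw [Ideal.map_sup, Ideal.map_span, ← Set.range_comp]
    rfl

theorem asympLe_sLength_amalgDup [IsNoetherianRing R] (hI : I ≠ ⊤) {p δ : ℕ} [ExpChar R p]
    [ExpChar (amalgDup I) p] {x : R} (hxI : x ∈ I) (hx : IsParam (Ideal.span {x}) δ) :
    AsympLe p δ (sLength (amalgDup I) (amalgDup I) p) (fun a e => 2 * sLength R R p a e) ∧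
    AsympLe p δ (fun a e => 2 * sLength R R p a e) (sLength (amalgDup I) (amalgDup I) p) := by
  let c : amalgDup I := amalgDiag I x
  have hc : IsParam (Ideal.span {c}) δ := by
    have := hx.map_amalgDiag I hI
    rwa [Ideal.map_span, Set.image_singleton] at this
  have hfin : ∀ b, Module.Finite (amalgDup I) (RestrictAlong (amalgProj I b)) := fun b =>
    Module.Finite.of_surjective (Algebra.linearMap _ _) (amalgProj_surjective I b)
  let f : amalgDup I →ₗ[amalgDup I] (Π b, RestrictAlong (amalgProj I b)) :=
    LinearMap.pi fun b => Algebra.linearMap _ _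
  -- Multiplication by x lands in I × I, which is contained in `R ⋈ I`.
  let g : (Π b, RestrictAlong (amalgProj I b)) →ₗ[amalgDup I] amalgDup I :=
    { toFun := fun v => ⟨(x * (show R from v true), x * (show R from v false)),
        I.sub_mem (I.mul_mem_right _ hxI) (I.mul_mem_right _ hxI)⟩
      map_add' := fun v w => Subtype.ext (Prod.ext (mul_add x _ _) (mul_add x _ _))
      map_smul' := fun a v => Subtype.ext (Prod.ext (mul_left_comm x _ _) (mul_left_comm x _ _)) }
  have e : sLength (amalgDup I) (Π b, RestrictAlong (amalgProj I b)) p =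
      fun a e => 2 * sLength R R p a e := by
    ext a e
    rw [sLength_pi]
    simp only [RestrictAlong.sLength_eq _ (amalgProj_surjective I _)]
    simp
  rw [← e]
  refine ⟨asympLe_of_range p hc g fun a => ⟨f a, ?_⟩, asympLe_of_range p hc f fun v => ⟨g v, ?_⟩⟩
  · rfl
  · ext b
    cases b <;> rfl

end Amalgam

/-! ### Equality of dimensions and the final computation. -/

lemma dimNat_eq {R : Type*} [CommRing R] {d : ℕ} (h : ringKrullDim R = d) : dimNat R = d := by
  rw [dimNat, h]
  rfl

lemma hSeqLocal_eq_normLength (R : Type*) [CommRing R] [IsLocalRing R] (p : ℕ) (s : ℝ) :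
    hSeqLocal R p s = normLength R R p (dimNat R) s := by
  ext e
  rw [normLength, mul_comm (dimNat R)]
  rfl

theorem corollary3p7 {R : Type*} [CommRing R] [IsLocalRing R] [IsNoetherianRing R]
    (p : ℕ) [Fact p.Prime] [CharP R p] (I : Ideal R) (hI : I ≠ ⊤)
    (hdim : ringKrullDim (R ⧸ I) < ringKrullDim R) (s : ℝ) (hs : 0 < s) :
    haveI : IsLocalRing (amalgDup I) := amalgDup_isLocalRing I hI
    -- the limits that define `h_s(R)` and `h_s(R ⋈ I)` exist
    Tendsto (hSeqLocal R p s) atTop (𝓝 (hLocal R p s)) ∧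
    Tendsto (hSeqLocal (amalgDup I) p s) atTop (𝓝 (hLocal (amalgDup I) p s)) ∧
    hLocal (amalgDup I) p s = 2 * hLocal R p s ∧
    sMultLocal (amalgDup I) p s = 2 * sMultLocal R p s := by
  have hloc : IsLocalRing (amalgDup I) := amalgDup_isLocalRing I hI
  have hpp : p.Prime := Fact.out
  have hexp : ExpChar R p := expChar_prime R p
  have hchar : CharP (amalgDup I) p := (CharP.charP_iff_prime_eq_zero hpp).2 (by
    rw [← map_natCast (amalgDiag I), CharP.cast_eq_zero, map_zero])
  have hexp' : ExpChar (amalgDup I) p := expChar_prime _ p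
  -- R/I is nonzero, so its dimension is at least 0 and dim R is positive.
  obtain ⟨δ, hδ⟩ : ∃ δ : ℕ, ringKrullDim R = (δ + 1 : ℕ) := by
    have : Nontrivial (R ⧸ I) := Ideal.Quotient.nontrivial_iff.2 hI
    obtain ⟨d, hd⟩ : ∃ d : ℕ, ringKrullDim R = d := by
      have h1 : (maximalIdeal R).height ≠ ⊤ := Ideal.height_ne_top (maximalIdeal.isMaximal R).ne_top
      obtain ⟨d, hd⟩ := ENat.ne_top_iff_exists.1 h1
      exact ⟨d, by rw [← maximalIdeal_height_eq_ringKrullDim, ← hd]; rfl⟩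
    have h0 : (0 : WithBot ℕ∞) < ringKrullDim R := ringKrullDim_nonneg_of_nontrivial.trans_lt hdim
    rw [hd] at h0
    have hd0 : 0 < d := by exact_mod_cast h0
    exact ⟨d - 1, by rw [hd, Nat.sub_add_cancel hd0]⟩
  have hIδ : ringKrullDim (R ⧸ I) ≤ δ := by
    rw [hδ] at hdim
    push_cast at hdim
    exact ENat.WithBot.lt_add_one_iff.1 hdim
  obtain ⟨x, hxI, hx⟩ := exists_mem_ringKrullDim_quotient_span_le hIδ hδ.le
  have hR : IsParam (⊥ : Ideal R) (δ + 1) := by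
    refine isParam_of_ringKrullDim_le ?_
    rw [ringKrullDim_eq_of_ringEquiv (RingEquiv.quotientBot R), hδ]
  -- Parameters of R give the upper bound, the surjection onto R the lower one. Equality makes both
  -- the powers of p and the factors `normFactor` coincide.
  have hdimA : ringKrullDim (amalgDup I) = (δ + 1 : ℕ) := by
    refine le_antisymm ?_ ?_
    · have h1 := hR.map_amalgDiag I hI
      rw [Ideal.map_bot] at h1
      exact h1.ringKrullDim_le
    · rw [← hδ]
      exact ringKrullDim_le_of_surjective _ (amalgProj_surjective I true)
  obtain ⟨L, hL⟩ := exists_tendsto_normLength_of_ringKrullDim_le (p := p) hδ.le hs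
  obtain ⟨⟨C, hC⟩, C', hC'⟩ := asympLe_sLength_amalgDup I hI (p := p) hxI
    (isParam_of_ringKrullDim_le hx)
  obtain ⟨C₀, hC₀⟩ := exists_sLength_le (M := R) p ⊥ (by simp) hR
  have hne : ∀ a e, sLength R R p a e ≠ ⊤ := fun a e =>
    ne_top_of_le_ne_top (ENat.natCast_ne_top _) (hC₀ a e)
  have hA : Tendsto (normLength (amalgDup I) (amalgDup I) p (δ + 1) s) atTop (𝓝 (2 * L)) := by
    refine tendsto_toNat_div_of_le hpp.one_lt (fun e => hC _ e) (fun e => hC' _ e)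
      (fun e => WithTop.mul_ne_top (by exact ENat.natCast_ne_top 2) (hne _ _))
      ((hL.const_mul 2).congr fun e => ?_)
    rw [ENat.toNat_mul, normLength, mul_div_assoc']
    simp
  have hR' : Tendsto (hSeqLocal R p s) atTop (𝓝 L) := by
    rw [hSeqLocal_eq_normLength, dimNat_eq hδ]
    exact hL
  have hA' : Tendsto (hSeqLocal (amalgDup I) p s) atTop (𝓝 (2 * L)) := by
    rw [hSeqLocal_eq_normLength, dimNat_eq hdimA]
    exact hA
  have e1 : hLocal R p s = L := hR'.limUnder_eq
  have e2 : hLocal (amalgDup I) p s = 2 * L := hA'.limUnder_eq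
  refine ⟨e1 ▸ hR', e2 ▸ hA', by rw [e1, e2], ?_⟩
  change hLocal (amalgDup I) p s / normFactor s (dimNat (amalgDup I)) =
    2 * (hLocal R p s / normFactor s (dimNat R))
  rw [e1, e2, dimNat_eq hδ, dimNat_eq hdimA, mul_div_assoc]
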